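/- Let $m\ge 2$, $n\ge 3$, $p\ge 2$ be integers. Consider the three complete DFAs $A_1,A_2,A_3$ over the 3-letter alphabet $\{a,b,c\}$ with state sets $Q_1=\{0,\dots,m-1\}$, $Q_2=\{0,\dots,n-1\}$, $Q_3=\{0,\dots,p-1\}$, initial state $0$, and single final state $m-1$, $n-1$, $p-1$ respectively. On a state set $\{0,\dots,k-1\}$ let $\mathrm{cyc}$ be the cycle $(0,1,\dots,k-1)$, $\mathrm{tr}$ the transposition $(0,1)$, $\mathrm{con}$ the contraction sending $1$ to $0$ and fixing every other state, and $\mathbf 1$ the identity. The letters act as follows: $$\begin{array}{c|ccc} & A_1 & A_2 & A_3\\ \hline c & \mathrm{tr} & \mathrm{con} & \mathbf 1\\ b & \mathrm{cyc} & \mathrm{tr} & \mathrm{con}\\ a & \mathbf 1 & \mathrm{cyc} & \mathrm{cyc}\end{array}$$ For NFAs $B,C$ with initial and final state sets $I_B,F_B,I_C,F_C$, let $B\cdot C$ be the NFA on the disjoint union of their state sets with final set $F_C$, initial set $I_B$, together with $I_C$ if $I_B\cap F_B\neq\emptyset$, and whose transitions are those of $B$ and $C$, except that whenever the set $q\cdot_B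 x$ reached from a state $q$ of $B$ by a letter $x$ meets $F_B$, the states of $I_C$ are also reached from $q$ by $x$. Let $A$ be the DFA obtained by the subset construction from the NFA $(A_1\cdot A_2)\cdot A_3$. Its states are identified with triples $(S_1,S_2,S_3)$, $S_i\subseteq Q_i$. Such a state is called valid if $S_1$ is a singleton, $S_k=\emptyset\Rightarrow S_{k+1}=\emptyset$ for $k=1,2$, and, for $k=1,2$, if $S_k$ contains the final state of $A_k$ then $0\in S_{k+1}$. The state complexity $\mathrm{sc}(L)$ of a regular language $L$ is the least number of states of a complete DFA recognizing $L$. Theorem. 1. The states of $A$ accessible from its initial state are exactly the valid states. 2. Any two distinct valid states of $A$ are non-equivalent, i.e. some word leads from exactly one of them to a final state. 3. The number of valid states is $$\#\mathcal T_3 = m-1+\tfrac38\,2^{p+n}(2m-1)+2^{p}(1-m).$$ 4. Consequently $\mathrm{sc}(L(A_1)L(A_2)L(A_3))=\#\mathcal T_3$, and $(A_1,A_2,A_3)$ is a 3-letter witness for the catenation of three languages: $\mathrm{sc}(L(A_1))=m$, $\mathrm{sc}(L(A_2))=n$, $\mathrm{sc}(L(A_3))=p$, and $\mathrm{sc}(L(A_1)L(A_2)L(A_3))$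 is the maximum of $\mathrm{sc}(L_1L_2L_3)$ over all triples of languages $L_1,L_2,L_3$ over a common finite alphabet (of any size) with $\mathrm{sc}(L_1)=m$, $\mathrm{sc}(L_2)=n$, $\mathrm{sc}(L_3)=p$. -/

import Mathlib

/-! ### State equivalence and state complexity -/

/-- Two states of a DFA are equivalent if the same words lead from them to an accepting state. -/
def DFA.StateEquiv {α σ : Type*} (M : DFA α σ) (s t : σ) : Prop :=
  ∀ w : List α, M.evalFrom s w ∈ M.accept ↔ M.evalFrom t w ∈ M.accept

/-- A state of a DFA is accessible if some word leads to it from the initial state. -/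
def DFA.Accessible {α σ : Type*} (M : DFA α σ) (s : σ) : Prop :=
  ∃ w : List α, M.eval w = s

/-- `L` is regular and has state complexity `k`: the least number of states of a complete DFA
recognizing `L` exists and equals `k`. -/
def HasStateComplexity {α : Type*} (L : Language α) (k : ℕ) : Prop :=
  IsLeast {c : ℕ | ∃ (Q : Type) (_ : Fintype Q) (M : DFA α Q),
    M.accepts = L ∧ Fintype.card Q = c} k

/-- The state complexities of all catenations `L₁ L₂ L₃`, where `L₁, L₂, L₃` are languages over a
common finite alphabet (which is not fixed), of respective state complexities `m, n, p`. -/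
def tripleCatComplexities (m n p : ℕ) : Set ℕ :=
  {k | ∃ (α : Type) (_ : Finite α) (L₁ L₂ L₃ : Language α),
    HasStateComplexity L₁ m ∧ HasStateComplexity L₂ n ∧ HasStateComplexity L₃ p ∧
      HasStateComplexity (L₁ * L₂ * L₃) k}

/-- `(L₁, L₂, L₃)` is a witness for the catenation of three languages at sizes `(m, n, p)`: the
languages have state complexities `m, n, p`, and the state complexity of `L₁ L₂ L₃` is the maximum
over all such triples, i.e. the value at `(m, n, p)` of the state complexity of the operation. -/
def IsTripleCatWitness {α : Type*} (m n p : ℕ) (L₁ L₂ L₃ : Language α) : Prop :=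
  HasStateComplexity L₁ m ∧ HasStateComplexity L₂ n ∧ HasStateComplexity L₃ p ∧
    ∃ k : ℕ, HasStateComplexity (L₁ * L₂ * L₃) k ∧ IsGreatest (tripleCatComplexities m n p) k

/-! ### The catenation automaton -/

/-- The catenation `A · B` of two NFAs, on the disjoint union of the state sets: whenever a
transition of `A` can reach a final state of `A`, the initial states of `B` are reached too. -/
def NFA.catenate {α σ τ : Type*} (A : NFA α σ) (B : NFA α τ) : NFA α (σ ⊕ τ) where
  step x a :=
    match x with
    | Sum.inl p => Sum.inl '' A.step p a ∪
        {y | (A.step p a ∩ A.accept).Nonempty ∧ y ∈ Sum.inr '' B.start}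
    | Sum.inr q => Sum.inr '' B.step q a
  start := Sum.inl '' A.start ∪
    {y | (A.start ∩ A.accept).Nonempty ∧ y ∈ Sum.inr '' B.start}
  accept := Sum.inr '' B.accept

/-- The DFA obtained by the subset construction from the NFA `(A₁ · A₂) · A₃`. -/
def tripleCatDFA {α Q₁ Q₂ Q₃ : Type*} (A₁ : DFA α Q₁) (A₂ : DFA α Q₂) (A₃ : DFA α Q₃) :
    DFA α (Set ((Q₁ ⊕ Q₂) ⊕ Q₃)) :=
  ((A₁.toNFA.catenate A₂.toNFA).catenate A₃.toNFA).toDFA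

/-- The first component `S₁ ⊆ Q₁` of a state of the catenation DFA. -/
def comp₁ {Q₁ Q₂ Q₃ : Type*} (X : Set ((Q₁ ⊕ Q₂) ⊕ Q₃)) : Set Q₁ :=
  {q | Sum.inl (Sum.inl q) ∈ X}

/-- The second component `S₂ ⊆ Q₂` of a state of the catenation DFA. -/
def comp₂ {Q₁ Q₂ Q₃ : Type*} (X : Set ((Q₁ ⊕ Q₂) ⊕ Q₃)) : Set Q₂ :=
  {q | Sum.inl (Sum.inr q) ∈ X}

/-- The third component `S₃ ⊆ Q₃` of a state of the catenation DFA. -/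
def comp₃ {Q₁ Q₂ Q₃ : Type*} (X : Set ((Q₁ ⊕ Q₂) ⊕ Q₃)) : Set Q₃ :=
  {q | Sum.inr q ∈ X}

/-- The valid states of the catenation DFA of `A₁, A₂, A₃`. -/
def validStates {α Q₁ Q₂ Q₃ : Type*} (A₁ : DFA α Q₁) (A₂ : DFA α Q₂) (A₃ : DFA α Q₃) :
    Set (Set ((Q₁ ⊕ Q₂) ⊕ Q₃)) :=
  {X | (∃ q, comp₁ X = {q}) ∧
    (comp₁ X = ∅ → comp₂ X = ∅) ∧ (comp₂ X = ∅ → comp₃ X = ∅) ∧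
    ((comp₁ X ∩ A₁.accept).Nonempty → A₂.start ∈ comp₂ X) ∧
    ((comp₂ X ∩ A₂.accept).Nonempty → A₃.start ∈ comp₃ X)}

/-! ### The three Brzozowski automata -/

/-- The three-letter alphabet. -/
inductive Letter : Type
  | a
  | b
  | c

/-- The cycle `(0, 1, …, n - 1)` (addition in `Fin n` is modulo `n`). -/
def cycleMap (n : ℕ) [NeZero n] (i : Fin n) : Fin n := i + 1

/-- The transposition `(0, 1)`. -/
def transpositionMap (n : ℕ) [NeZero n] (i : Fin n) : Fin n := Equiv.swap 0 1 i

/-- The contraction of state `1` to state `0`. -/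
def contractionMap (n : ℕ) [NeZero n] (i : Fin n) : Fin n := if i = 1 then 0 else i

/-- The DFA with states `0, …, n - 1`, initial state `0` and unique final state `n - 1`, on which
each letter `x` acts as the transformation `f x`. -/
def brzozowskiDFA (n : ℕ) [NeZero n] (f : Letter → Fin n → Fin n) : DFA Letter (Fin n) where
  step q x := f x q
  start := 0
  accept := {q | (q : ℕ) + 1 = n}

/-- `A₁`: the letters `a, b, c` act as the identity, the cycle, the transposition. -/
def witnessDFA₁ (m : ℕ) [NeZero m] : DFA Letter (Fin m) :=
  brzozowskiDFA m fun x =>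
    match x with
    | Letter.a => id
    | Letter.b => cycleMap m
    | Letter.c => transpositionMap m

/-- `A₂`: the letters `a, b, c` act as the cycle, the transposition, the contraction. -/
def witnessDFA₂ (n : ℕ) [NeZero n] : DFA Letter (Fin n) :=
  brzozowskiDFA n fun x =>
    match x with
    | Letter.a => cycleMap n
    | Letter.b => transpositionMap n
    | Letter.c => contractionMap n

/-- `A₃`: the letters `a, b, c` act as the cycle, the contraction, the identity. -/
def witnessDFA₃ (p : ℕ) [NeZero p] : DFA Letter (Fin p) :=
  brzozowskiDFA p fun x =>
    match x with
    | Letter.a => cycleMap p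
    | Letter.b => contractionMap p
    | Letter.c => id

/-! The first automaton is never in two states at once, so the subset automaton reduces to a
deterministic automaton on triples `(q, S, T)` (`tripleDFA`). Valid triples are closed under its
transitions for any three DFAs. This gives one half of accessibility and, through counting, the
upper bound for all triples of languages.

Final states are written `-1`, so that the cycle is `+ 1` in `Fin k`. That every valid triple is
accessible (`acc_of_val`) follows by induction on the cardinality of `T`, then on that of `S`.
Turning back by `a` keeps cardinalities. A step whose target has `-1 ∈ S` creates `0 ∈ T` by itself,
so this element can be left out of the predecessor, and `T` shrinks. Likewise `q = -1` creates `0 ∈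
S`, and `S` shrinks. The word `ac` turns `T` and the nonzero part of `S` while holding `0 ∈ S`. The
word `b` changes `q` without changing `S` and `T` when `0, 1 ∈ S` and `1 ∉ T`. These moves bring
every valid triple down to a smaller one or to one with `S ⊆ {0}` and `T = ∅`.

Equivalent triples are equal (`eq_of_stateEquiv`), the components being recovered in the order
third, second, first. Powers of `a` bring any element of `T` to the final state. For `S`, the word
`ab` turns a difference between the second components while contracting `T` into `{0}`; once the
difference reaches `-1 - 1`, one `a` makes it visible in the third component. For `q`, the word
`acac` keeps `q` and contracts `S` into `{0}`, after which one `a` shows in the second component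
whether `q = -1`.

The count splits according to whether `q` is final (`ncard_validTriples_eq`). More final states only
shrink the set of valid triples, and so does a final initial state in the second automaton, hence
the maximality (`ncard_validTriples_le`). -/

/-! ### The language of a catenation -/

namespace NFA

variable {α σ τ : Type*} (A : NFA α σ) (B : NFA α τ)

theorem inl_mem_eval_catenate (w : List α) (q : σ) :
    Sum.inl q ∈ (A.catenate B).eval w ↔ q ∈ A.eval w := by
  induction w using List.reverseRecOn generalizing q with
  | nil => simp [catenate]
  | append_singleton w a ih =>
    simp only [eval_append_singleton, mem_stepSet, Sum.exists, ih]
    simp [catenate]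

/-- A run in `B` records the place `u` where it left `A`. In the induction, the last letter is
either the one on which the run jumps, and then `v = []`, or a letter read inside `B`. -/
theorem inr_mem_eval_catenate (w : List α) (r : τ) :
    Sum.inr r ∈ (A.catenate B).eval w ↔ ∃ u v, u ++ v = w ∧ u ∈ A.accepts ∧ r ∈ B.eval v := by
  induction w using List.reverseRecOn generalizing r with
  | nil =>
    simp only [List.append_eq_nil_iff, eval_nil]
    constructor
    · intro h
      have h' : (A.start ∩ A.accept).Nonempty ∧ r ∈ B.start := by simpa [catenate] using h
      obtain ⟨⟨q, hq, hqa⟩, hr⟩ := h'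
      exact ⟨[], [], ⟨rfl, rfl⟩, ⟨q, hqa, hq⟩, hr⟩
    · rintro ⟨_, _, ⟨rfl, rfl⟩, ⟨q, hqa, hq⟩, hr⟩
      have : (A.start ∩ A.accept).Nonempty ∧ r ∈ B.start := ⟨⟨q, hq, hqa⟩, hr⟩
      simpa [catenate] using this
  | append_singleton w a ih =>
    simp only [eval_append_singleton, mem_stepSet, Sum.exists, ih, inl_mem_eval_catenate]
    constructor
    · rintro (⟨q, hq, h⟩ | ⟨r', ⟨u, v, rfl, hu, hv⟩, h⟩)
      · have h' : (A.step q a ∩ A.accept).Nonempty ∧ r ∈ B.start := by simpa [catenate] using h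
        obtain ⟨⟨q', hq', hqa⟩, hr⟩ := h'
        refine ⟨w ++ [a], [], by simp, ⟨q', hqa, ?_⟩, hr⟩
        rw [eval_append_singleton]
        exact mem_stepSet.2 ⟨q, hq, hq'⟩
      · have h' : r ∈ B.step r' a := by simpa [catenate] using h
        refine ⟨u, v ++ [a], by simp, hu, ?_⟩
        rw [eval_append_singleton]
        exact mem_stepSet.2 ⟨r', hv, h'⟩
    · rintro ⟨u, v, huv, hu, hv⟩
      rcases List.eq_nil_or_concat v with rfl | ⟨v, b, rfl⟩
      · left
        obtain ⟨q', hqa, hq'⟩ := hu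
        rw [List.append_nil] at huv
        subst huv
        rw [eval_append_singleton] at hq'
        obtain ⟨q, hq, hqq⟩ := mem_stepSet.1 hq'
        have : (A.step q a ∩ A.accept).Nonempty ∧ r ∈ B.start := ⟨⟨q', hqq, hqa⟩, hv⟩
        exact ⟨q, hq, by simpa [catenate] using this⟩
      · right
        rw [List.concat_eq_append] at huv hv
        rw [← List.append_assoc, List.append_singleton_inj] at huv
        obtain ⟨rfl, rfl⟩ := huv
        rw [eval_append_singleton] at hv
        obtain ⟨r', hr', h⟩ := mem_stepSet.1 hv
        exact ⟨r', ⟨u, v, rfl, hu, hr'⟩, by simpa [catenate] using h⟩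

theorem accepts_catenate : (A.catenate B).accepts = A.accepts * B.accepts := by
  ext w
  rw [Language.mem_mul]
  constructor
  · rintro ⟨x, ⟨r, hr, rfl⟩, hx⟩
    obtain ⟨u, v, h, hu, hv⟩ := (inr_mem_eval_catenate A B w r).1 hx
    exact ⟨u, hu, v, ⟨r, hr, hv⟩, h⟩
  · rintro ⟨u, hu, v, ⟨r, hr, hv⟩, h⟩
    exact ⟨Sum.inr r, ⟨r, hr, rfl⟩, (inr_mem_eval_catenate A B w r).2 ⟨u, v, h, hu, hv⟩⟩

end NFA

theorem accepts_tripleCatDFA {α Q₁ Q₂ Q₃ : Type*} (A₁ : DFA α Q₁) (A₂ : DFA α Q₂)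
    (A₃ : DFA α Q₃) :
    (tripleCatDFA A₁ A₂ A₃).accepts = A₁.accepts * A₂.accepts * A₃.accepts := by
  simp only [tripleCatDFA, NFA.toDFA_correct, NFA.accepts_catenate, DFA.toNFA_correct]

/-! ### State complexity -/

namespace DFA

variable {α σ τ : Type*}

theorem Accessible.start (M : DFA α σ) : M.Accessible M.start := ⟨[], rfl⟩

theorem Accessible.step {M : DFA α σ} {s : σ} (h : M.Accessible s) (a : α) :
    M.Accessible (M.step s a) := by
  obtain ⟨w, rfl⟩ := h
  exact ⟨w ++ [a], M.eval_append_singleton w a⟩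

theorem Accessible.mem_of_closed {M : DFA α σ} {V : Set σ} (h₀ : M.start ∈ V)
    (h₁ : ∀ s ∈ V, ∀ a, M.step s a ∈ V) {s : σ} (h : M.Accessible s) : s ∈ V := by
  obtain ⟨w, rfl⟩ := h
  induction w using List.reverseRecOn with
  | nil => exact h₀
  | append_singleton w a ih =>
    rw [eval_append_singleton]
    exact h₁ _ ih a

theorem StateEquiv.step {M : DFA α σ} {s t : σ} (h : M.StateEquiv s t) (a : α) :
    M.StateEquiv (M.step s a) (M.step t a) :=
  fun w => h (a :: w)

theorem StateEquiv.symm {M : DFA α σ} {s t : σ} (h : M.StateEquiv s t) : M.StateEquiv t s :=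
  fun w => (h w).symm

theorem StateEquiv.mem_accept {M : DFA α σ} {s t : σ} (h : M.StateEquiv s t) :
    s ∈ M.accept ↔ t ∈ M.accept :=
  h []

/-- Pairwise inequivalent accessible states are at most as many as the states of any DFA
recognizing the same language. -/
theorem ncard_le_card_of_inequivalent (M : DFA α σ) {V : Set σ}
    (hV : ∀ s ∈ V, M.Accessible s) (hne : ∀ s ∈ V, ∀ t ∈ V, s ≠ t → ¬ M.StateEquiv s t)
    {Q : Type*} [Fintype Q] (N : DFA α Q) (hN : N.accepts = M.accepts) :
    V.ncard ≤ Fintype.card Q := by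
  -- With one access word for each state of `V`, sending a state to where `N` arrives on its word is
  -- injective, since `N` tells inequivalent states apart.
  choose! w hw using hV
  rw [← Nat.card_eq_fintype_card, ← Set.ncard_univ]
  refine Set.ncard_le_ncard_of_injOn (fun s => N.eval (w s)) (fun _ _ => Set.mem_univ _) ?_
    Set.finite_univ
  intro s hs t ht hst
  by_contra hne'
  refine hne s hs t ht hne' fun x => ?_
  have key : ∀ r ∈ V, M.evalFrom r x ∈ M.accept ↔ N.evalFrom (N.eval (w r)) x ∈ N.accept := by
    intro r hr
    have h : w r ++ x ∈ M.accepts ↔ w r ++ x ∈ N.accepts := by rw [hN]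
    rw [mem_accepts, mem_accepts, eval, eval, evalFrom_of_append, evalFrom_of_append] at h
    have hr' : M.evalFrom M.start (w r) = r := hw r hr
    rwa [hr'] at h
  have hst' : N.eval (w s) = N.eval (w t) := hst
  rw [key s hs, key t ht, hst']

/-- The restriction of a DFA to a set of states closed under the transitions. -/
def restrict (M : DFA α σ) (V : Set σ) (h₀ : M.start ∈ V)
    (h₁ : ∀ s ∈ V, ∀ a, M.step s a ∈ V) : DFA α V where
  step s a := ⟨M.step s a, h₁ s s.2 a⟩
  start := ⟨M.start, h₀⟩
  accept := {s | (s : σ) ∈ M.accept}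

theorem accepts_restrict (M : DFA α σ) (V : Set σ) (h₀ : M.start ∈ V)
    (h₁ : ∀ s ∈ V, ∀ a, M.step s a ∈ V) : (M.restrict V h₀ h₁).accepts = M.accepts := by
  have key : ∀ w, (((M.restrict V h₀ h₁).eval w : V) : σ) = M.eval w := by
    intro w
    induction w using List.reverseRecOn with
    | nil => rfl
    | append_singleton w a ih =>
      rw [eval_append_singleton, eval_append_singleton, ← ih]
      rfl
  ext w
  rw [mem_accepts, mem_accepts, ← key]
  rfl

end DFA

theorem HasStateComplexity.le_ncard {α σ : Type} {L : Language α} {k : ℕ}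
    (h : HasStateComplexity L k) (M : DFA α σ) (hM : M.accepts = L) (V : Set σ) (hV : V.Finite)
    (h₀ : M.start ∈ V) (h₁ : ∀ s ∈ V, ∀ a, M.step s a ∈ V) : k ≤ V.ncard := by
  have := hV.fintype
  refine h.2 ⟨V, inferInstance, M.restrict V h₀ h₁, ?_, ?_⟩
  · rw [DFA.accepts_restrict, hM]
  · rw [← Nat.card_coe_set_eq, Nat.card_eq_fintype_card]

theorem hasStateComplexity_ncard {α σ : Type} (M : DFA α σ) (V : Set σ) (hV : V.Finite)
    (hacc : ∀ s, M.Accessible s ↔ s ∈ V)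
    (hne : ∀ s ∈ V, ∀ t ∈ V, s ≠ t → ¬ M.StateEquiv s t) :
    HasStateComplexity M.accepts V.ncard := by
  have := hV.fintype
  constructor
  · refine ⟨V, inferInstance, M.restrict V ((hacc _).1 (.start M))
      (fun s hs a => (hacc _).1 (((hacc s).2 hs).step a)), DFA.accepts_restrict _ _ _ _, ?_⟩
    rw [← Nat.card_coe_set_eq, Nat.card_eq_fintype_card]
  · rintro c ⟨Q, _, N, hN, rfl⟩
    exact M.ncard_le_card_of_inequivalent (fun s hs => (hacc s).2 hs) hne N hN

/-- Without accepting states the language is empty, and one state suffices for it. -/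
theorem HasStateComplexity.accept_nonempty {α Q : Type} {k : ℕ} (M : DFA α Q)
    (h : HasStateComplexity M.accepts k) (hk : 2 ≤ k) : M.accept.Nonempty := by
  by_contra hM
  rw [Set.not_nonempty_iff_eq_empty] at hM
  have h1 : k ≤ 1 := h.2 ⟨Unit, inferInstance, ⟨fun _ _ => (), (), ∅⟩, by
    ext w
    simp [DFA.mem_accepts, hM], rfl⟩
  omega

/-! ### States of the catenation automaton as triples -/

section Triples

variable {α Q₁ Q₂ Q₃ : Type*} (A₁ : DFA α Q₁) (A₂ : DFA α Q₂) (A₃ : DFA α Q₃)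

/-- The catenation automaton on triples `(q, S, T)` made of a state of the first automaton and
sets of states of the other two. -/
def tripleDFA : DFA α (Q₁ × Set Q₂ × Set Q₃) where
  step s x :=
    (A₁.step s.1 x,
      {r | (∃ r' ∈ s.2.1, A₂.step r' x = r) ∨ A₁.step s.1 x ∈ A₁.accept ∧ r = A₂.start},
      {t | (∃ t' ∈ s.2.2, A₃.step t' x = t) ∨
        ((∃ r ∈ s.2.1, A₂.step r x ∈ A₂.accept) ∨
          A₁.step s.1 x ∈ A₁.accept ∧ A₂.start ∈ A₂.accept) ∧ t = A₃.start})
  start := (A₁.start, {r | A₁.start ∈ A₁.accept ∧ r = A₂.start},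
    {t | (A₁.start ∈ A₁.accept ∧ A₂.start ∈ A₂.accept) ∧ t = A₃.start})
  accept := {s | (s.2.2 ∩ A₃.accept).Nonempty}

/-- The state of the subset automaton given by a triple. -/
def tripleToSet (s : Q₁ × Set Q₂ × Set Q₃) : Set ((Q₁ ⊕ Q₂) ⊕ Q₃) :=
  Sum.elim (Sum.elim (· = s.1) (· ∈ s.2.1)) (· ∈ s.2.2)

@[simp] theorem inl_inl_mem_tripleToSet (s : Q₁ × Set Q₂ × Set Q₃) (q : Q₁) :
    Sum.inl (Sum.inl q) ∈ tripleToSet s ↔ q = s.1 := Iff.rfl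

@[simp] theorem inl_inr_mem_tripleToSet (s : Q₁ × Set Q₂ × Set Q₃) (q : Q₂) :
    Sum.inl (Sum.inr q) ∈ tripleToSet s ↔ q ∈ s.2.1 := Iff.rfl

@[simp] theorem inr_mem_tripleToSet (s : Q₁ × Set Q₂ × Set Q₃) (q : Q₃) :
    Sum.inr q ∈ tripleToSet s ↔ q ∈ s.2.2 := Iff.rfl

theorem tripleToSet_injective :
    Function.Injective (tripleToSet : Q₁ × Set Q₂ × Set Q₃ → _) := by
  rintro ⟨q, S, T⟩ ⟨q', S', T'⟩ h
  rw [Set.ext_iff] at h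
  refine Prod.ext ?_ (Prod.ext ?_ ?_)
  · exact (h (Sum.inl (Sum.inl q))).1 rfl
  · exact Set.ext fun r => h (Sum.inl (Sum.inr r))
  · exact Set.ext fun t => h (Sum.inr t)

theorem step_tripleToSet (s : Q₁ × Set Q₂ × Set Q₃) (x : α) :
    (tripleCatDFA A₁ A₂ A₃).step (tripleToSet s) x =
      tripleToSet ((tripleDFA A₁ A₂ A₃).step s x) := by
  obtain ⟨q, S, T⟩ := s
  change NFA.stepSet _ (tripleToSet (q, S, T)) x = _
  ext y
  rw [NFA.mem_stepSet]
  rcases y with (y | y) | y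
  · simp [tripleDFA, NFA.catenate, Set.Nonempty]
  · simp [tripleDFA, NFA.catenate, Set.Nonempty]
    grind
  · simp [tripleDFA, NFA.catenate, Set.Nonempty]
    grind

theorem start_tripleCatDFA :
    (tripleCatDFA A₁ A₂ A₃).start = tripleToSet (tripleDFA A₁ A₂ A₃).start := by
  change (NFA.catenate _ _).start = _
  ext y
  rcases y with (y | y) | y <;> simp [tripleDFA, NFA.catenate, Set.Nonempty]

theorem tripleToSet_mem_accept (s : Q₁ × Set Q₂ × Set Q₃) :
    tripleToSet s ∈ (tripleCatDFA A₁ A₂ A₃).accept ↔ s ∈ (tripleDFA A₁ A₂ A₃).accept := by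
  change (∃ y ∈ tripleToSet s, y ∈ (NFA.catenate _ _).accept) ↔ _
  simp [tripleDFA, NFA.catenate, Set.Nonempty]

theorem evalFrom_tripleToSet (s : Q₁ × Set Q₂ × Set Q₃) (w : List α) :
    (tripleCatDFA A₁ A₂ A₃).evalFrom (tripleToSet s) w =
      tripleToSet ((tripleDFA A₁ A₂ A₃).evalFrom s w) := by
  induction w generalizing s with
  | nil => rfl
  | cons a w ih => rw [DFA.evalFrom_cons, DFA.evalFrom_cons, step_tripleToSet, ih]

theorem accessible_tripleCatDFA_iff (X : Set ((Q₁ ⊕ Q₂) ⊕ Q₃)) :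
    (tripleCatDFA A₁ A₂ A₃).Accessible X ↔
      ∃ s, (tripleDFA A₁ A₂ A₃).Accessible s ∧ tripleToSet s = X := by
  simp only [DFA.Accessible, DFA.eval, start_tripleCatDFA, evalFrom_tripleToSet]
  simp

theorem stateEquiv_tripleToSet_iff (s t : Q₁ × Set Q₂ × Set Q₃) :
    (tripleCatDFA A₁ A₂ A₃).StateEquiv (tripleToSet s) (tripleToSet t) ↔
      (tripleDFA A₁ A₂ A₃).StateEquiv s t := by
  simp only [DFA.StateEquiv, evalFrom_tripleToSet, tripleToSet_mem_accept]

/-- The valid triples. -/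
def validTriples (F₁ : Set Q₁) (i₂ : Q₂) (F₂ : Set Q₂) (i₃ : Q₃) : Set (Q₁ × Set Q₂ × Set Q₃) :=
  {s | (s.2.1 = ∅ → s.2.2 = ∅) ∧ (s.1 ∈ F₁ → i₂ ∈ s.2.1) ∧ (∀ r ∈ s.2.1, r ∈ F₂ → i₃ ∈ s.2.2)}

theorem validStates_eq_image :
    validStates A₁ A₂ A₃ =
      tripleToSet '' validTriples A₁.accept A₂.start A₂.accept A₃.start := by
  ext X
  constructor
  · rintro ⟨⟨q, hq⟩, -, h₂, h₃, h₄⟩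
    refine ⟨(q, comp₂ X, comp₃ X), ⟨h₂, fun h => h₃ ⟨q, by simp [hq], h⟩,
      fun r hr hF => h₄ ⟨r, hr, hF⟩⟩, ?_⟩
    ext y
    rcases y with (y | y) | y
    · rw [inl_inl_mem_tripleToSet]
      change y ∈ ({q} : Set Q₁) ↔ _
      rw [← hq]
      rfl
    · rfl
    · rfl
  · rintro ⟨⟨q, S, T⟩, ⟨h₁, h₂, h₃⟩, rfl⟩
    have e₁ : comp₁ (tripleToSet (q, S, T)) = {q} := rfl
    have e₂ : comp₂ (tripleToSet (q, S, T)) = S := rfl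
    have e₃ : comp₃ (tripleToSet (q, S, T)) = T := rfl
    refine ⟨⟨q, e₁⟩, ?_, ?_, ?_, ?_⟩
    · simp [e₁]
    · rwa [e₂, e₃]
    · rw [e₁, e₂]
      rintro ⟨_, rfl, h⟩
      exact h₂ h
    · rw [e₂, e₃]
      rintro ⟨r, hr, h⟩
      exact h₃ r hr h

theorem start_mem_validTriples :
    (tripleDFA A₁ A₂ A₃).start ∈ validTriples A₁.accept A₂.start A₂.accept A₃.start := by
  refine ⟨fun h => ?_, fun h => ⟨h, rfl⟩, ?_⟩
  · refine Set.eq_empty_of_forall_notMem fun t ht => ?_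
    exact h.subset (show A₂.start ∈ _ from ⟨ht.1.1, rfl⟩)
  · rintro r ⟨h, rfl⟩ hr
    exact ⟨⟨h, hr⟩, rfl⟩

theorem step_mem_validTriples {s : Q₁ × Set Q₂ × Set Q₃}
    (hs : s ∈ validTriples A₁.accept A₂.start A₂.accept A₃.start) (x : α) :
    (tripleDFA A₁ A₂ A₃).step s x ∈ validTriples A₁.accept A₂.start A₂.accept A₃.start := by
  obtain ⟨h₁, h₂, h₃⟩ := hs
  refine ⟨fun h => ?_, fun h => Or.inr ⟨h, rfl⟩, ?_⟩
  · refine Set.eq_empty_of_forall_notMem fun t ht => ?_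
    have hS : s.2.1 = ∅ := Set.eq_empty_of_forall_notMem fun r hr =>
      h.subset (show A₂.step r x ∈ _ from Or.inl ⟨r, hr, rfl⟩)
    rcases ht with ⟨t', ht', -⟩ | ⟨⟨r, hr, -⟩ | ⟨hq, -⟩, -⟩
    · rw [h₁ hS] at ht'
      exact ht'
    · rw [hS] at hr
      exact hr
    · exact h.subset (show A₂.start ∈ _ from Or.inr ⟨hq, rfl⟩)
  · rintro r (⟨r', hr', rfl⟩ | ⟨hq, rfl⟩) hr
    · exact Or.inr ⟨Or.inl ⟨r', hr', hr⟩, rfl⟩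
    · exact Or.inr ⟨Or.inr ⟨hq, hr⟩, rfl⟩

theorem accessible_mem_validTriples {s : Q₁ × Set Q₂ × Set Q₃}
    (h : (tripleDFA A₁ A₂ A₃).Accessible s) :
    s ∈ validTriples A₁.accept A₂.start A₂.accept A₃.start :=
  h.mem_of_closed (start_mem_validTriples A₁ A₂ A₃)
    fun _ hs x => step_mem_validTriples A₁ A₂ A₃ hs x

theorem accepts_tripleDFA :
    (tripleDFA A₁ A₂ A₃).accepts = A₁.accepts * A₂.accepts * A₃.accepts := by
  rw [← accepts_tripleCatDFA]
  ext w
  rw [DFA.mem_accepts, DFA.mem_accepts, DFA.eval, DFA.eval, start_tripleCatDFA,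
    evalFrom_tripleToSet, tripleToSet_mem_accept]

end Triples

/-! ### The number of valid triples -/

section Counting

variable {Q₁ Q₂ Q₃ : Type*} [Fintype Q₁] [Fintype Q₂] [Fintype Q₃]

/-- The sets in question form an interval of the subset lattice. -/
theorem ncard_setOf_mem {Q : Type*} [Fintype Q] (i : Q) :
    {S : Set Q | i ∈ S}.ncard = 2 ^ (Fintype.card Q - 1) := by
  classical
  have h : {S : Set Q | i ∈ S} = (fun S : Finset Q => (S : Set Q)) '' (Finset.Icc {i} Finset.univ) := by
    ext S
    simp only [Set.mem_ofPred_eq, Set.mem_image, Finset.coe_Icc, Set.mem_Icc]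
    constructor
    · intro hS
      exact ⟨S.toFinite.toFinset, by simp [hS], by simp⟩
    · rintro ⟨S, hS, rfl⟩
      simpa using hS
  rw [h, Set.ncard_image_of_injective _ Finset.coe_injective, Set.ncard_coe_finset,
    Finset.card_Icc_finset (Finset.subset_univ _), Finset.card_univ, Finset.card_singleton]

theorem ncard_setOf_notMem {Q : Type*} [Fintype Q] (i : Q) :
    {S : Set Q | i ∉ S}.ncard = 2 ^ (Fintype.card Q - 1) := by
  rw [← ncard_setOf_mem i]
  refine Set.ncard_congr (fun S _ => Sᶜ) (fun S hS => hS) (fun S T _ _ h => compl_injective h)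
    fun S hS => ⟨Sᶜ, fun h => h hS, compl_compl S⟩

theorem ncard_setOf_mem_mem {Q : Type*} [Fintype Q] {i j : Q} (hij : i ≠ j) :
    {S : Set Q | i ∈ S ∧ j ∈ S}.ncard = 2 ^ (Fintype.card Q - 2) := by
  classical
  have h : {S : Set Q | i ∈ S ∧ j ∈ S} =
      (fun S : Finset Q => (S : Set Q)) '' (Finset.Icc {i, j} Finset.univ) := by
    ext S
    simp only [Set.mem_ofPred_eq, Set.mem_image, Finset.coe_Icc, Set.mem_Icc]
    constructor
    · intro hS
      exact ⟨S.toFinite.toFinset, by simp [Set.insert_subset_iff, hS], by simp⟩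
    · rintro ⟨S, hS, rfl⟩
      simpa [Finset.insert_subset_iff] using hS
  rw [h, Set.ncard_image_of_injective _ Finset.coe_injective, Set.ncard_coe_finset,
    Finset.card_Icc_finset (Finset.subset_univ _), Finset.card_univ, Finset.card_pair hij]

theorem ncard_setOf_mem_notMem {Q : Type*} [Fintype Q] {i j : Q} (hij : i ≠ j) :
    {S : Set Q | i ∈ S ∧ j ∉ S}.ncard = 2 ^ (Fintype.card Q - 2) := by
  classical
  rw [← ncard_setOf_mem_mem hij]
  refine Set.ncard_congr (fun S _ => insert j S) (fun S hS => ?_) (fun S T hS hT h => ?_)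
    fun S hS => ⟨S \ {j}, ?_, ?_⟩
  · exact ⟨Or.inr hS.1, Or.inl rfl⟩
  · rw [← Set.insert_sdiff_self_of_notMem hS.2, ← Set.insert_sdiff_self_of_notMem hT.2, h]
  · exact ⟨⟨hS.1, hij⟩, fun h => h.2 rfl⟩
  · rw [Set.insert_sdiff_singleton, Set.insert_eq_of_mem hS.2]

/-- The fibre of the valid triples over a final state. -/
theorem ncard_fibre_final {i j : Q₂} (hij : i ≠ j) (k : Q₃) :
    {s : Set Q₂ × Set Q₃ | i ∈ s.1 ∧ (j ∈ s.1 → k ∈ s.2)}.ncard =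
      2 ^ (Fintype.card Q₂ - 2) * 2 ^ (Fintype.card Q₃ - 1) +
        2 ^ (Fintype.card Q₂ - 2) * 2 ^ Fintype.card Q₃ := by
  have h : {s : Set Q₂ × Set Q₃ | i ∈ s.1 ∧ (j ∈ s.1 → k ∈ s.2)} =
      ({S : Set Q₂ | i ∈ S ∧ j ∈ S} ×ˢ {T : Set Q₃ | k ∈ T}) ∪
      ({S : Set Q₂ | i ∈ S ∧ j ∉ S} ×ˢ (Set.univ : Set (Set Q₃))) := by
    ext ⟨S, T⟩
    simp only [Set.mem_ofPred_eq, Set.mem_union, Set.mem_prod, Set.mem_univ]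
    tauto
  rw [h, Set.ncard_union_eq, Set.ncard_prod, Set.ncard_prod, ncard_setOf_mem_mem hij,
    ncard_setOf_mem_notMem hij, ncard_setOf_mem, Set.ncard_univ, Nat.card_eq_fintype_card,
    Fintype.card_set]
  · rw [Set.disjoint_left]
    rintro ⟨S, T⟩ h₁ h₂
    exact h₂.1.2 h₁.1.2

theorem ncard_fibre_final_self (i : Q₂) (k : Q₃) :
    {s : Set Q₂ × Set Q₃ | i ∈ s.1 ∧ (i ∈ s.1 → k ∈ s.2)}.ncard =
      2 ^ (Fintype.card Q₂ - 1) * 2 ^ (Fintype.card Q₃ - 1) := by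
  have h : {s : Set Q₂ × Set Q₃ | i ∈ s.1 ∧ (i ∈ s.1 → k ∈ s.2)} =
      {S : Set Q₂ | i ∈ S} ×ˢ {T : Set Q₃ | k ∈ T} := by
    ext ⟨S, T⟩
    simp only [Set.mem_ofPred_eq, Set.mem_prod]
    tauto
  rw [h, Set.ncard_prod, ncard_setOf_mem, ncard_setOf_mem]

/-- The three summands count the pair of empty sets, the pairs with `j ∈ S`, which force `k ∈ T`,
and the pairs with `S` nonempty and `j ∉ S`, where `T` is free. -/
theorem ncard_fibre_nonfinal (j : Q₂) (k : Q₃) :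
    {s : Set Q₂ × Set Q₃ | (s.1 = ∅ → s.2 = ∅) ∧ (j ∈ s.1 → k ∈ s.2)}.ncard =
      1 + 2 ^ (Fintype.card Q₂ - 1) * 2 ^ (Fintype.card Q₃ - 1) +
        (2 ^ (Fintype.card Q₂ - 1) - 1) * 2 ^ Fintype.card Q₃ := by
  have h : {s : Set Q₂ × Set Q₃ | (s.1 = ∅ → s.2 = ∅) ∧ (j ∈ s.1 → k ∈ s.2)} =
      (({(∅, ∅)} : Set (Set Q₂ × Set Q₃)) ∪ ({S : Set Q₂ | j ∈ S} ×ˢ {T : Set Q₃ | k ∈ T})) ∪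
      (({S : Set Q₂ | j ∉ S} \ {∅}) ×ˢ (Set.univ : Set (Set Q₃))) := by
    ext ⟨S, T⟩
    simp only [Set.mem_ofPred_eq, Set.mem_union, Set.mem_prod, Set.mem_univ, Set.mem_singleton_iff,
      Prod.mk.injEq, Set.mem_sdiff]
    have : j ∈ S → S ≠ ∅ := by
      rintro h rfl
      exact h
    tauto
  rw [h, Set.ncard_union_eq, Set.ncard_union_eq, Set.ncard_singleton, Set.ncard_prod,
    Set.ncard_prod, ncard_setOf_mem, ncard_setOf_mem, Set.ncard_univ, Nat.card_eq_fintype_card,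
    Fintype.card_set, Set.ncard_sdiff_singleton_of_mem, ncard_setOf_notMem]
  · exact fun h => h
  · rw [Set.disjoint_left]
    rintro ⟨S, T⟩ h₁ h₂
    rw [Set.mem_singleton_iff, Prod.mk.injEq] at h₁
    obtain ⟨rfl, rfl⟩ := h₁
    exact h₂.1
  · rw [Set.disjoint_left]
    rintro ⟨S, T⟩ (h₁ | h₁) h₂
    · rw [Set.mem_singleton_iff, Prod.mk.injEq] at h₁
      exact h₂.1.2 h₁.1
    · exact h₂.1.1 h₁.1

theorem ncard_validTriples_singleton (f : Q₁) (i j : Q₂) (k : Q₃) :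
    (validTriples {f} i {j} k).ncard =
      {s : Set Q₂ × Set Q₃ | i ∈ s.1 ∧ (j ∈ s.1 → k ∈ s.2)}.ncard +
      (Fintype.card Q₁ - 1) *
        {s : Set Q₂ × Set Q₃ | (s.1 = ∅ → s.2 = ∅) ∧ (j ∈ s.1 → k ∈ s.2)}.ncard := by
  classical
  have h : (validTriples {f} i {j} k) =
      (({f} : Set Q₁) ×ˢ {s : Set Q₂ × Set Q₃ | i ∈ s.1 ∧ (j ∈ s.1 → k ∈ s.2)}) ∪
      (({f}ᶜ : Set Q₁) ×ˢ
        {s : Set Q₂ × Set Q₃ | (s.1 = ∅ → s.2 = ∅) ∧ (j ∈ s.1 → k ∈ s.2)}) := by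
    ext ⟨q, S, T⟩
    simp only [validTriples, Set.mem_ofPred_eq, Set.mem_union, Set.mem_prod, Set.mem_compl_iff,
      Set.mem_singleton_iff]
    have : i ∈ S → S ≠ ∅ := by
      rintro h rfl
      exact h
    have h' : (∀ r ∈ S, r = j → k ∈ T) ↔ (j ∈ S → k ∈ T) :=
      ⟨fun h hj => h j hj rfl, by rintro h _ hr rfl; exact h hr⟩
    rw [h']
    tauto
  rw [h, Set.ncard_union_eq, Set.ncard_prod, Set.ncard_prod, Set.ncard_singleton, one_mul,
    Set.ncard_compl, Set.ncard_singleton, Nat.card_eq_fintype_card]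
  rw [Set.disjoint_left]
  rintro ⟨S, T⟩ h₁ h₂
  exact h₂.1 h₁.1

/-- The number of valid triples when the first two automata have a unique final state and that of
the second is not initial. -/
theorem ncard_validTriples_eq (f : Q₁) {i j : Q₂} (hij : i ≠ j) (k : Q₃) :
    (validTriples {f} i {j} k).ncard =
      2 ^ (Fintype.card Q₂ - 2) * 2 ^ (Fintype.card Q₃ - 1) +
        2 ^ (Fintype.card Q₂ - 2) * 2 ^ Fintype.card Q₃ +
      (Fintype.card Q₁ - 1) *
        (1 + 2 ^ (Fintype.card Q₂ - 1) * 2 ^ (Fintype.card Q₃ - 1) +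
          (2 ^ (Fintype.card Q₂ - 1) - 1) * 2 ^ Fintype.card Q₃) := by
  rw [ncard_validTriples_singleton, ncard_fibre_final hij, ncard_fibre_nonfinal]

/-- Each further final state only adds constraints, so one in each automaton is kept. If the one
kept in the second automaton is initial, the fibre over `f` is smaller still. -/
theorem ncard_validTriples_le (hn : 2 ≤ Fintype.card Q₂) {F₁ : Set Q₁} (hF₁ : F₁.Nonempty)
    (i : Q₂) {F₂ : Set Q₂} (hF₂ : F₂.Nonempty) (k : Q₃) :
    (validTriples F₁ i F₂ k).ncard ≤
      2 ^ (Fintype.card Q₂ - 2) * 2 ^ (Fintype.card Q₃ - 1) +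
        2 ^ (Fintype.card Q₂ - 2) * 2 ^ Fintype.card Q₃ +
      (Fintype.card Q₁ - 1) *
        (1 + 2 ^ (Fintype.card Q₂ - 1) * 2 ^ (Fintype.card Q₃ - 1) +
          (2 ^ (Fintype.card Q₂ - 1) - 1) * 2 ^ Fintype.card Q₃) := by
  obtain ⟨f, hf⟩ := hF₁
  obtain ⟨j, hj⟩ := hF₂
  have hsub : validTriples F₁ i F₂ k ⊆ validTriples {f} i {j} k := by
    rintro s ⟨h₁, h₂, h₃⟩
    refine ⟨h₁, fun h => h₂ ?_, fun r hr h => h₃ r hr ?_⟩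
    · rwa [Set.mem_singleton_iff.1 h]
    · rwa [Set.mem_singleton_iff.1 h]
  refine (Set.ncard_le_ncard hsub (Set.toFinite _)).trans ?_
  by_cases hij : i = j
  · subst hij
    rw [ncard_validTriples_singleton, ncard_fibre_final_self, ncard_fibre_nonfinal]
    gcongr
    obtain ⟨n, hn⟩ := Nat.exists_eq_add_of_le' hn
    have : 0 < Fintype.card Q₃ := Fintype.card_pos_iff.2 ⟨k⟩
    obtain ⟨p, hp⟩ := Nat.exists_eq_add_of_le' this
    simp only [hn, hp, Nat.add_sub_cancel, show n + 2 - 1 = n + 1 by omega, pow_succ]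
    -- With `N = 2 ^ n` and `P = 2 ^ p`, this is `2NP ≤ NP + 2NP`.
    nlinarith [Nat.zero_le (2 ^ n * 2 ^ p)]
  · rw [ncard_validTriples_eq f hij k]

theorem cast_ncard_formula (m n p : ℕ) (hm : 1 ≤ m) (hn : 2 ≤ n) (hp : 1 ≤ p) :
    ((2 ^ (n - 2) * 2 ^ (p - 1) + 2 ^ (n - 2) * 2 ^ p +
      (m - 1) * (1 + 2 ^ (n - 1) * 2 ^ (p - 1) + (2 ^ (n - 1) - 1) * 2 ^ p) : ℕ) : ℚ) =
      (m : ℚ) - 1 + 3 / 8 * 2 ^ (p + n) * (2 * (m : ℚ) - 1) + 2 ^ p * (1 - (m : ℚ)) := by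
  obtain ⟨m, rfl⟩ := Nat.exists_eq_add_of_le' hm
  obtain ⟨n, rfl⟩ := Nat.exists_eq_add_of_le' hn
  obtain ⟨p, rfl⟩ := Nat.exists_eq_add_of_le' hp
  simp only [Nat.add_sub_cancel, show n + 2 - 1 = n + 1 by omega]
  push_cast [Nat.one_le_two_pow]
  ring

end Counting

/-! ### The catenation of the three Brzozowski automata -/

namespace Brzozowski

theorem mem_accept_iff {n : ℕ} [NeZero n] {f : Letter → Fin n → Fin n} (q : Fin n) :
    q ∈ (brzozowskiDFA n f).accept ↔ q = -1 := by
  have hn : 0 < n := Nat.pos_of_ne_zero (NeZero.ne n)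
  change (q : ℕ) + 1 = n ↔ _
  rw [eq_neg_iff_add_eq_zero, Fin.ext_iff, Fin.val_add]
  rcases Nat.lt_or_ge 1 n with h | h
  · have h1 : ((1 : Fin n) : ℕ) = 1 := by rw [Fin.val_one', Nat.mod_eq_of_lt h]
    rw [h1, Fin.val_zero]
    constructor
    · intro h
      rw [h, Nat.mod_self]
    · intro h
      have := Nat.le_of_dvd (by omega) (Nat.dvd_of_mod_eq_zero h)
      omega
  · obtain rfl : n = 1 := by omega
    simp

theorem one_ne_zero' {n : ℕ} [NeZero n] (hn : 2 ≤ n) : (1 : Fin n) ≠ 0 := by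
  intro h
  have := congrArg Fin.val h
  rw [Fin.val_one', Nat.mod_eq_of_lt (by omega), Fin.val_zero] at this
  omega

theorem neg_one_ne_zero' {n : ℕ} [NeZero n] (hn : 2 ≤ n) : (-1 : Fin n) ≠ 0 := by
  rw [Ne, neg_eq_zero]
  exact one_ne_zero' hn

theorem neg_one_ne_one {n : ℕ} [NeZero n] (hn : 3 ≤ n) : (-1 : Fin n) ≠ 1 := by
  intro h
  rw [neg_eq_iff_add_eq_zero, Fin.ext_iff, Fin.val_add, Fin.val_one',
    Nat.mod_eq_of_lt (show 1 < n by omega), Fin.val_zero, Nat.mod_eq_of_lt (by omega)] at h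
  omega

theorem exists_nsmul {n : ℕ} [NeZero n] (x : Fin n) : ∃ k : ℕ, x = k • (1 : Fin n) := by
  obtain ⟨k, hk⟩ := x
  induction k with
  | zero => exact ⟨0, by rw [zero_nsmul]; rfl⟩
  | succ k ih =>
    obtain ⟨j, hj⟩ := ih (by omega)
    refine ⟨j + 1, ?_⟩
    rw [succ_nsmul, ← hj, Fin.ext_iff, Fin.val_add, Fin.val_one',
      Nat.mod_eq_of_lt (show 1 < n by omega), Nat.mod_eq_of_lt hk]

theorem exists_add_nsmul {n : ℕ} [NeZero n] (x y : Fin n) : ∃ k : ℕ, x = y + k • (1 : Fin n) := by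
  obtain ⟨k, hk⟩ := exists_nsmul (x - y)
  exact ⟨k, by rw [← hk, add_sub_cancel]⟩

theorem exists_sub_nsmul {n : ℕ} [NeZero n] (x y : Fin n) : ∃ k : ℕ, x = y - k • (1 : Fin n) := by
  obtain ⟨k, hk⟩ := exists_nsmul (y - x)
  exact ⟨k, by rw [← hk, sub_sub_cancel]⟩

theorem exists_contractionMap {n : ℕ} [NeZero n] (hn : 2 ≤ n) (S : Set (Fin n)) (r : Fin n) :
    (∃ r' ∈ S, contractionMap n r' = r) ↔ r ≠ 1 ∧ r ∈ S ∨ r = 0 ∧ 1 ∈ S := by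
  have h1 := one_ne_zero' hn
  simp only [contractionMap]
  constructor
  · rintro ⟨r', hr', rfl⟩
    split_ifs with h
    · exact Or.inr ⟨rfl, h ▸ hr'⟩
    · exact Or.inl ⟨h, hr'⟩
  · rintro (⟨h, hr⟩ | ⟨rfl, h⟩)
    · exact ⟨r, hr, if_neg h⟩
    · exact ⟨1, h, if_pos rfl⟩

theorem exists_transpositionMap {n : ℕ} [NeZero n] (S : Set (Fin n)) (r : Fin n) :
    (∃ r' ∈ S, transpositionMap n r' = r) ↔ Equiv.swap 0 1 r ∈ S := by
  constructor
  · rintro ⟨r', hr', rfl⟩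
    rwa [transpositionMap, Equiv.swap_apply_self]
  · intro h
    exact ⟨_, h, Equiv.swap_apply_self _ _ _⟩

theorem exists_cycleMap {n : ℕ} [NeZero n] (S : Set (Fin n)) (r : Fin n) :
    (∃ r' ∈ S, cycleMap n r' = r) ↔ r - 1 ∈ S := by
  constructor
  · rintro ⟨r', hr', rfl⟩
    rwa [cycleMap, add_sub_cancel_right]
  · intro h
    exact ⟨_, h, sub_add_cancel _ _⟩

section

variable {m n p : ℕ} [NeZero m] [NeZero n] [NeZero p]

/-- The catenation automaton of the three Brzozowski automata, on triples. -/
abbrev catDFA (m n p : ℕ) [NeZero m] [NeZero n] [NeZero p] :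
    DFA Letter (Fin m × Set (Fin n) × Set (Fin p)) :=
  tripleDFA (witnessDFA₁ m) (witnessDFA₂ n) (witnessDFA₃ p)

/-- As `0 ≠ -1` in the second automaton, a run that has just entered it is not at its final state,
so one letter never starts the second and the third automaton in succession. -/
theorem step_catDFA (hn : 2 ≤ n) (s : Fin m × Set (Fin n) × Set (Fin p)) (x : Letter) :
    (catDFA m n p).step s x =
      ((witnessDFA₁ m).step s.1 x,
      {r | (∃ r' ∈ s.2.1, (witnessDFA₂ n).step r' x = r) ∨
        (witnessDFA₁ m).step s.1 x = -1 ∧ r = 0},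
      {t | (∃ t' ∈ s.2.2, (witnessDFA₃ p).step t' x = t) ∨
        (∃ r ∈ s.2.1, (witnessDFA₂ n).step r x = -1) ∧ t = 0}) := by
  have h0 : (0 : Fin n) ≠ -1 := (neg_one_ne_zero' hn).symm
  refine Prod.ext rfl (Prod.ext ?_ ?_)
  · ext r
    change _ ∨ _ ∈ (brzozowskiDFA _ _).accept ∧ _ ↔ _
    rw [mem_accept_iff]
    rfl
  · ext t
    change _ ∨ ((∃ r ∈ s.2.1, _ ∈ (brzozowskiDFA _ _).accept) ∨
      _ ∈ (brzozowskiDFA _ _).accept ∧ (0 : Fin n) ∈ (brzozowskiDFA _ _).accept) ∧ t = 0 ↔ _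
    simp only [mem_accept_iff, h0, and_false, or_false]
    rfl

theorem step_a (hn : 2 ≤ n) (q : Fin m) (S : Set (Fin n)) (T : Set (Fin p)) :
    (catDFA m n p).step (q, S, T) Letter.a =
      (q, {r | r - 1 ∈ S ∨ q = -1 ∧ r = 0}, {t | t - 1 ∈ T ∨ -1 - 1 ∈ S ∧ t = 0}) := by
  rw [step_catDFA hn]
  refine Prod.ext rfl (Prod.ext ?_ ?_)
  · ext r
    exact or_congr (exists_cycleMap S r) Iff.rfl
  · ext t
    exact or_congr (exists_cycleMap T t) (and_congr (exists_cycleMap S (-1)) Iff.rfl)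

theorem step_b (hn : 3 ≤ n) (hp : 2 ≤ p) (q : Fin m) (S : Set (Fin n)) (T : Set (Fin p)) :
    (catDFA m n p).step (q, S, T) Letter.b =
      (q + 1, {r | Equiv.swap 0 1 r ∈ S ∨ q + 1 = -1 ∧ r = 0},
        {t | (t ≠ 1 ∧ t ∈ T ∨ t = 0 ∧ 1 ∈ T) ∨ -1 ∈ S ∧ t = 0}) := by
  rw [step_catDFA (by omega)]
  refine Prod.ext rfl (Prod.ext ?_ ?_)
  · ext r
    exact or_congr (exists_transpositionMap S r) Iff.rfl
  · ext t
    refine or_congr (exists_contractionMap hp T t) (and_congr ?_ Iff.rfl)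
    refine (exists_transpositionMap S (-1)).trans ?_
    rw [Equiv.swap_apply_of_ne_of_ne (neg_one_ne_zero' (by omega)) (neg_one_ne_one hn)]

theorem step_c (hn : 3 ≤ n) (q : Fin m) (S : Set (Fin n)) (T : Set (Fin p)) :
    (catDFA m n p).step (q, S, T) Letter.c =
      (Equiv.swap 0 1 q, {r | (r ≠ 1 ∧ r ∈ S ∨ r = 0 ∧ 1 ∈ S) ∨ Equiv.swap 0 1 q = -1 ∧ r = 0},
        {t | t ∈ T ∨ -1 ∈ S ∧ t = 0}) := by
  rw [step_catDFA (by omega)]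
  refine Prod.ext rfl (Prod.ext ?_ ?_)
  · ext r
    exact or_congr (exists_contractionMap (by omega) S r) Iff.rfl
  · ext t
    refine or_congr ⟨?_, fun h => ⟨t, h, rfl⟩⟩ (and_congr ?_ Iff.rfl)
    · rintro ⟨t', h, rfl⟩
      exact h
    · refine (exists_contractionMap (by omega) S (-1)).trans ?_
      simp [neg_one_ne_one hn, neg_one_ne_zero' (show 2 ≤ n by omega)]

theorem mem_accept_catDFA (s : Fin m × Set (Fin n) × Set (Fin p)) :
    s ∈ (catDFA m n p).accept ↔ -1 ∈ s.2.2 := by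
  constructor
  · rintro ⟨t, ht, h⟩
    rwa [← (mem_accept_iff t).1 h]
  · intro h
    exact ⟨-1, h, (mem_accept_iff _).2 rfl⟩

theorem start_catDFA (hm : 2 ≤ m) :
    (catDFA m n p).start = (0, ∅, ∅) := by
  have h0 : (0 : Fin m) ∉ (witnessDFA₁ m).accept := fun h =>
    neg_one_ne_zero' hm ((mem_accept_iff _).1 h).symm
  refine Prod.ext rfl (Prod.ext ?_ ?_)
  · exact Set.eq_empty_of_forall_notMem fun r hr => h0 hr.1
  · exact Set.eq_empty_of_forall_notMem fun r hr => h0 hr.1.1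

end

/-! ### The Brzozowski automata are minimal -/

theorem hasStateComplexity_brzozowskiDFA {n : ℕ} [NeZero n] {f : Letter → Fin n → Fin n}
    {x : Letter} (hx : f x = cycleMap n) :
    HasStateComplexity (brzozowskiDFA n f).accepts n := by
  have hstep : ∀ q, (brzozowskiDFA n f).step q x = q + 1 := fun q => congrFun hx q
  have h := hasStateComplexity_ncard (brzozowskiDFA n f) Set.univ Set.finite_univ
    (fun s => ⟨fun _ => Set.mem_univ _, fun _ => ?_⟩) fun s _ t _ hst h => hst ?_
  · rwa [Set.ncard_univ, Nat.card_eq_fintype_card, Fintype.card_fin] at h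
  · obtain ⟨k, rfl⟩ := exists_nsmul s
    induction k with
    | zero => rw [zero_nsmul]; exact .start _
    | succ k ih =>
      rw [succ_nsmul, ← hstep]
      exact (ih (Set.mem_univ _)).step x
  -- After `k` cycles `s` is at the final state; being equivalent, `t` is there too, and the cycle
  -- is injective.
  · obtain ⟨k, hk⟩ := exists_sub_nsmul s (-1)
    induction k generalizing s t with
    | zero =>
      rw [zero_nsmul, sub_zero] at hk
      rw [hk]
      exact ((mem_accept_iff t).1 (h.mem_accept.1 ((mem_accept_iff s).2 hk))).symm
    | succ k ih =>
      have h' := h.step x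
      rw [hstep, hstep] at h'
      refine add_right_cancel (ih (s + 1) (Set.mem_univ _) (t + 1) (Set.mem_univ _) ?_ h' ?_)
      · exact fun e => hst (add_right_cancel e)
      · rw [hk, succ_nsmul]
        abel

end Brzozowski

/-! ### Accessibility of the valid states -/

namespace Brzozowski

/-! ### Turning sets back by the cycle. -/

section Cardinalities

variable {n : ℕ} [NeZero n] {S : Set (Fin n)}

theorem ncard_shift (S : Set (Fin n)) : {r | r + 1 ∈ S}.ncard = S.ncard :=
  Set.ncard_preimage_of_injective_subset_range (f := fun r : Fin n => r + 1)
    (add_left_injective 1) fun r _ => ⟨r - 1, sub_add_cancel r 1⟩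

theorem ncard_shift_diff_lt (h0 : 0 ∈ S) : {r | r + 1 ∈ S ∧ r + 1 ≠ 0}.ncard < S.ncard := by
  have h : {r | r + 1 ∈ S ∧ r + 1 ≠ 0} = {r | r + 1 ∈ S \ {0}} := rfl
  rw [h, ncard_shift]
  exact Set.ncard_sdiff_singleton_lt_of_mem h0

theorem ncard_hold (h0 : 0 ∈ S) (h1 : 1 ∉ S) :
    {r | r = 0 ∨ r + 1 ∈ S ∧ r + 1 ≠ 0}.ncard = S.ncard := by
  have h : {r | r = 0 ∨ r + 1 ∈ S ∧ r + 1 ≠ 0} = insert 0 {r | r + 1 ∈ S \ {0}} := rfl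
  rw [h, Set.ncard_insert_of_notMem, ncard_shift, Set.ncard_sdiff_singleton_add_one h0]
  rintro ⟨h, -⟩
  rw [zero_add] at h
  exact h1 h

theorem mem_iff_shift {P : Prop} (hP : P → 0 ∈ S) (r : Fin n) :
    r ∈ S ↔ r - 1 ∈ {r | r + 1 ∈ S} ∨ P ∧ r = 0 := by
  rw [Set.mem_ofPred_eq, sub_add_cancel]
  grind

/-- When the step itself creates `0`, the predecessor need not contain the preimage of `0`; this is
what makes the cardinality drop. -/
theorem mem_iff_shift_diff {P : Prop} (hP : P) (h0 : 0 ∈ S) (r : Fin n) :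
    r ∈ S ↔ r - 1 ∈ {r | r + 1 ∈ S ∧ r + 1 ≠ 0} ∨ P ∧ r = 0 := by
  rw [Set.mem_ofPred_eq, sub_add_cancel]
  grind

end Cardinalities

variable {m n p : ℕ} [NeZero m] [NeZero n] [NeZero p]

/-- The triple `(q, S, T)` is accessible in the catenation automaton. -/
abbrev Acc (q : Fin m) (S : Set (Fin n)) (T : Set (Fin p)) : Prop :=
  (catDFA m n p).Accessible (q, S, T)

/-- The triple `(q, S, T)` is valid. -/
def Val (q : Fin m) (S : Set (Fin n)) (T : Set (Fin p)) : Prop :=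
  (S = ∅ → T = ∅) ∧ (q = -1 → 0 ∈ S) ∧ (-1 ∈ S → 0 ∈ T)

theorem Val.of_nonempty {q : Fin m} {S : Set (Fin n)} {T : Set (Fin p)} {r : Fin n} (hr : r ∈ S)
    (h₁ : q = -1 → 0 ∈ S) (h₂ : -1 ∈ S → 0 ∈ T) : Val q S T :=
  ⟨by rintro rfl; exact hr.elim, h₁, h₂⟩

/-- The creation of `0 ∈ T` is tested on the target `S`, not on the source: the validity of the
target is then exactly what is needed. The element `0` newly created in `S` does not interfere,
because `0 ≠ -1`. -/
theorem Acc.a (hn : 3 ≤ n) {q : Fin m} {S₀ S : Set (Fin n)} {T₀ T : Set (Fin p)}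
    (h : Acc q S₀ T₀) (hS : ∀ r, r ∈ S ↔ r - 1 ∈ S₀ ∨ q = -1 ∧ r = 0)
    (hT : ∀ t, t ∈ T ↔ t - 1 ∈ T₀ ∨ -1 ∈ S ∧ t = 0) : Acc q S T := by
  have h' := h.step Letter.a
  rw [step_a (by omega)] at h'
  have hS' : S = {r | r - 1 ∈ S₀ ∨ q = -1 ∧ r = 0} := Set.ext hS
  have hT' : T = {t | t - 1 ∈ T₀ ∨ -1 - 1 ∈ S₀ ∧ t = 0} := by
    ext t
    rw [hT, hS]
    simp [neg_one_ne_zero' (show 2 ≤ n by omega)]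
  rwa [Acc, hS', hT']

theorem Acc.b (hn : 3 ≤ n) (hp : 2 ≤ p) {q q' : Fin m} {S₀ S : Set (Fin n)} {T₀ T : Set (Fin p)}
    (h : Acc q S₀ T₀) (hq : q' = q + 1) (hS : ∀ r, r ∈ S ↔ Equiv.swap 0 1 r ∈ S₀ ∨ q' = -1 ∧ r = 0)
    (hT : ∀ t, t ∈ T ↔ (t ≠ 1 ∧ t ∈ T₀ ∨ t = 0 ∧ 1 ∈ T₀) ∨ -1 ∈ S ∧ t = 0) : Acc q' S T := by
  have h' := h.step Letter.b
  rw [step_b hn hp] at h'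
  subst hq
  have hS' : S = {r | Equiv.swap 0 1 r ∈ S₀ ∨ q + 1 = -1 ∧ r = 0} := Set.ext hS
  have hT' : T = {t | (t ≠ 1 ∧ t ∈ T₀ ∨ t = 0 ∧ 1 ∈ T₀) ∨ -1 ∈ S₀ ∧ t = 0} := by
    ext t
    rw [hT, hS,
      Equiv.swap_apply_of_ne_of_ne (neg_one_ne_zero' (by omega)) (neg_one_ne_one hn)]
    simp [neg_one_ne_zero' (show 2 ≤ n by omega)]
  rwa [Acc, hS', hT']

theorem Acc.c (hn : 3 ≤ n) {q q' : Fin m} {S₀ S : Set (Fin n)} {T₀ T : Set (Fin p)}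
    (h : Acc q S₀ T₀) (hq : q' = Equiv.swap 0 1 q)
    (hS : ∀ r, r ∈ S ↔ (r ≠ 1 ∧ r ∈ S₀ ∨ r = 0 ∧ 1 ∈ S₀) ∨ q' = -1 ∧ r = 0)
    (hT : ∀ t, t ∈ T ↔ t ∈ T₀ ∨ -1 ∈ S ∧ t = 0) : Acc q' S T := by
  have h' := h.step Letter.c
  rw [step_c hn] at h'
  subst hq
  have hS' : S = {r | (r ≠ 1 ∧ r ∈ S₀ ∨ r = 0 ∧ 1 ∈ S₀) ∨ Equiv.swap 0 1 q = -1 ∧ r = 0} :=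
    Set.ext hS
  have hT' : T = {t | t ∈ T₀ ∨ -1 ∈ S₀ ∧ t = 0} := by
    ext t
    rw [hT, hS]
    simp [neg_one_ne_zero' (show 2 ≤ n by omega), neg_one_ne_one hn]
  rwa [Acc, hS', hT']

/-- The word `ac` turns the elements of `S` other than `0`, which it keeps. -/
theorem Acc.ac (hn : 3 ≤ n) {q : Fin m} {S : Set (Fin n)} {T₀ T : Set (Fin p)}
    (h0 : 0 ∈ S) (h1 : 1 ∉ S)
    (h : Acc (Equiv.swap 0 1 q) {r | r = 0 ∨ r + 1 ∈ S ∧ r + 1 ≠ 0} T₀)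
    (hT : ∀ t, t ∈ T ↔ t - 1 ∈ T₀ ∨ -1 ∈ S ∧ t = 0) : Acc q S T := by
  have hn0 := neg_one_ne_zero' (show 2 ≤ n by omega)
  have hn1 := neg_one_ne_one hn
  have h10 := one_ne_zero' (show 2 ≤ n by omega)
  have hS1 : -1 ∈ {r | r = 1 ∨ r ∈ S ∧ r ≠ 0 ∨ Equiv.swap 0 1 q = -1 ∧ r = 0} ↔ -1 ∈ S := by
    simp [hn0, hn1]
  have h' : Acc (Equiv.swap 0 1 q)
      -- The letter `a` moves the held `0` to `1`, and `c` contracts it back. A `0` created on the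
      -- way by a final first component is harmless, since `0 ∈ S`.
      {r | r = 1 ∨ r ∈ S ∧ r ≠ 0 ∨ Equiv.swap 0 1 q = -1 ∧ r = 0} T := by
    refine h.a hn (fun r => ?_) fun t => ?_
    · simp only [Set.mem_ofPred_eq, sub_add_cancel, sub_eq_zero]
      tauto
    · rw [hS1, hT]
  refine h'.c hn (Equiv.swap_apply_self _ _ _).symm (fun r => ?_) fun t => ?_
  · simp only [Set.mem_ofPred_eq]
    grind
  · rw [hT]
    tauto

/-! ### Predecessors of valid triples. -/

theorem acc_of_not_final (hn : 3 ≤ n) {q : Fin m} {S : Set (Fin n)} {T : Set (Fin p)}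
    (hq : q ≠ -1) (hST : -1 ∈ S → 0 ∈ T) (h : Acc q {r | r + 1 ∈ S} {t | t + 1 ∈ T}) :
    Acc q S T :=
  h.a hn (mem_iff_shift fun h => (hq h).elim) (mem_iff_shift hST)

/-- Since `-1 ∈ S`, the letter `a` creates `0 ∈ T`, so `T` shrinks going back. The hypothesis `h01`
is the validity of the predecessor: `0 ∈ S` turns back to `-1`, and `1 ∈ T` to `0`. -/
theorem acc_of_not_final_of_last_mem (hn : 3 ≤ n) (hp : 2 ≤ p) {q : Fin m} {S : Set (Fin n)}
    {T : Set (Fin p)} (hq : q ≠ -1) (hST : 0 ∈ T) (hS : -1 ∈ S) (h01 : 0 ∈ S → 1 ∈ T)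
    (ih : ∀ (q' : Fin m) (S' : Set (Fin n)) (T' : Set (Fin p)), Val q' S' T' →
      T'.ncard < T.ncard → Acc q' S' T') : Acc q S T := by
  refine (ih q {r | r + 1 ∈ S} {t | t + 1 ∈ T ∧ t + 1 ≠ 0} ?_ (ncard_shift_diff_lt hST)).a hn
    (mem_iff_shift fun h => (hq h).elim) (mem_iff_shift_diff hS hST)
  refine Val.of_nonempty (r := -1 - 1) ?_ (fun h => (hq h).elim) fun h => ?_
  · rwa [Set.mem_ofPred_eq, sub_add_cancel]
  · rw [Set.mem_ofPred_eq, neg_add_cancel] at h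
    rw [Set.mem_ofPred_eq, zero_add]
    exact ⟨h01 h, one_ne_zero' hp⟩

/-- The held set contains `0` and never `-1`, so nothing is required of `q` or `T`. -/
theorem val_hold (hn : 3 ≤ n) (q : Fin m) (S : Set (Fin n)) (T : Set (Fin p)) :
    Val q {r | r = 0 ∨ r + 1 ∈ S ∧ r + 1 ≠ 0} T := by
  refine Val.of_nonempty (Or.inl rfl) (fun _ => Or.inl rfl) ?_
  rintro (h | h)
  · exact (neg_one_ne_zero' (by omega) h).elim
  · exact (h.2 (neg_add_cancel _)).elim

theorem acc_of_hold_of_last_mem (hn : 3 ≤ n) {q : Fin m} {S : Set (Fin n)}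
    {T : Set (Fin p)} (h0 : 0 ∈ S) (h1 : 1 ∉ S) (hS : -1 ∈ S) (hST : 0 ∈ T)
    (ih : ∀ (q' : Fin m) (S' : Set (Fin n)) (T' : Set (Fin p)), Val q' S' T' →
      T'.ncard < T.ncard → Acc q' S' T') : Acc q S T :=
  Acc.ac hn h0 h1 (ih _ _ _ (val_hold hn _ S _) (ncard_shift_diff_lt hST))
    (mem_iff_shift_diff hS hST)

/-- The final first component creates `0 ∈ S`, so `S` shrinks going back; `1 ∈ S` turns back to the
`0` that validity demands there. -/
theorem acc_of_final_of_zero_mem_of_one_mem (hn : 3 ≤ n) {S : Set (Fin n)}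
    {T : Set (Fin p)} (h0 : 0 ∈ S) (h1 : 1 ∈ S) (hST : -1 ∈ S → 0 ∈ T)
    (ih : ∀ (q' : Fin m) (S' : Set (Fin n)) (T' : Set (Fin p)), Val q' S' T' →
      T'.ncard = T.ncard → S'.ncard < S.ncard → Acc q' S' T') : Acc (-1 : Fin m) S T := by
  have h0' : (0 : Fin n) ∈ {r | r + 1 ∈ S ∧ r + 1 ≠ 0} := by
    rw [Set.mem_ofPred_eq, zero_add]
    exact ⟨h1, one_ne_zero' (by omega)⟩
  refine (ih (-1) {r | r + 1 ∈ S ∧ r + 1 ≠ 0} {t | t + 1 ∈ T} ?_ (ncard_shift T)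
    (ncard_shift_diff_lt h0)).a hn (mem_iff_shift_diff rfl h0) (mem_iff_shift hST)
  exact Val.of_nonempty h0' (fun _ => h0') fun h => (h.2 (neg_add_cancel _)).elim

/-- Under these hypotheses `b` leaves `S` and `T` unchanged and only advances the first component,
so it is enough to reach `q = -1`. -/
theorem acc_of_zero_mem_of_one_mem_of_one_notMem (hn : 3 ≤ n) (hp : 2 ≤ p) {q : Fin m}
    {S : Set (Fin n)} {T : Set (Fin p)} (h0 : 0 ∈ S) (h1 : 1 ∈ S) (hST : -1 ∈ S → 0 ∈ T)
    (hT : 1 ∉ T)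
    (ih : ∀ (q' : Fin m) (S' : Set (Fin n)) (T' : Set (Fin p)), Val q' S' T' →
      T'.ncard = T.ncard → S'.ncard < S.ncard → Acc q' S' T') : Acc q S T := by
  obtain ⟨k, rfl⟩ := exists_add_nsmul q (-1)
  induction k with
  | zero =>
    rw [zero_nsmul, add_zero]
    exact acc_of_final_of_zero_mem_of_one_mem hn h0 h1 hST ih
  | succ k ihk =>
    refine ihk.b hn hp (by rw [succ_nsmul, add_assoc]) (fun r => ?_) fun t => ?_
    · by_cases hr0 : r = 0
      · simp [hr0, h0, h1]
      · by_cases hr1 : r = 1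
        · simp [hr1, h0, h1]
        · rw [Equiv.swap_apply_of_ne_of_ne hr0 hr1]
          simp [hr0]
    · grind

theorem acc_of_zero_mem_of_one_mem (hn : 3 ≤ n) (hp : 2 ≤ p) {q : Fin m}
    {S : Set (Fin n)} {T : Set (Fin p)} (h0 : 0 ∈ S) (h1 : 1 ∈ S) (hST : -1 ∈ S → 0 ∈ T)
    (ihT : ∀ (q' : Fin m) (S' : Set (Fin n)) (T' : Set (Fin p)), Val q' S' T' →
      T'.ncard < T.ncard → Acc q' S' T')
    (ihS : ∀ (q' : Fin m) (S' : Set (Fin n)) (T' : Set (Fin p)), Val q' S' T' →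
      T'.ncard = T.ncard → S'.ncard < S.ncard → Acc q' S' T') : Acc q S T := by
  by_cases hT : 1 ∈ T
  swap
  · exact acc_of_zero_mem_of_one_mem_of_one_notMem hn hp h0 h1 hST hT ihS
  by_cases hq : q = -1
  · subst hq
    exact acc_of_final_of_zero_mem_of_one_mem hn h0 h1 hST ihS
  by_cases hS : -1 ∈ S
  · exact acc_of_not_final_of_last_mem hn hp hq (hST hS) hS (fun _ => hT) ihT
  -- One turn back, `0 ∈ S` has become `-1` and `1 ∈ T` has become `0`. The turned triple falls
  -- under one of the preceding lemmas, and the induction hypotheses still apply because the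
  -- cardinalities are the same.
  refine acc_of_not_final hn hq hST ?_
  have h0S : (0 : Fin n) ∈ {r | r + 1 ∈ S} := by rwa [Set.mem_ofPred_eq, zero_add]
  have hS' : (-1 : Fin n) ∈ {r | r + 1 ∈ S} := by rwa [Set.mem_ofPred_eq, neg_add_cancel]
  have h0T : (0 : Fin p) ∈ {t | t + 1 ∈ T} := by rwa [Set.mem_ofPred_eq, zero_add]
  rw [← ncard_shift T] at ihT ihS
  rw [← ncard_shift S] at ihS
  by_cases h1S : (1 : Fin n) ∈ {r | r + 1 ∈ S}
  · by_cases h1T : (1 : Fin p) ∈ {t | t + 1 ∈ T}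
    · exact acc_of_not_final_of_last_mem hn hp hq h0T hS' (fun _ => h1T) ihT
    · exact acc_of_zero_mem_of_one_mem_of_one_notMem hn hp h0S h1S (fun _ => h0T) h1T ihS
  · exact acc_of_hold_of_last_mem hn h0S h1S hS' h0T ihT

/-- Going back by `ac` brings a nonzero element of `S` down towards `1` while `0` stays. If `-1`
turns up in `S` with `1 ∉ S`, then `T` can be shrunk instead. -/
theorem acc_of_zero_mem_of_mem (hn : 3 ≤ n) (hp : 2 ≤ p) (k : ℕ) {q : Fin m}
    {S : Set (Fin n)} {T : Set (Fin p)} (h0 : 0 ∈ S) (hk : 1 + k • 1 ∈ S)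
    (hk0 : (1 : Fin n) + k • 1 ≠ 0) (hST : -1 ∈ S → 0 ∈ T)
    (ihT : ∀ (q' : Fin m) (S' : Set (Fin n)) (T' : Set (Fin p)), Val q' S' T' →
      T'.ncard < T.ncard → Acc q' S' T')
    (ihS : ∀ (q' : Fin m) (S' : Set (Fin n)) (T' : Set (Fin p)), Val q' S' T' →
      T'.ncard = T.ncard → S'.ncard < S.ncard → Acc q' S' T') : Acc q S T := by
  induction k generalizing q S T with
  | zero =>
    rw [zero_nsmul, add_zero] at hk
    exact acc_of_zero_mem_of_one_mem hn hp h0 hk hST ihT ihS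
  | succ k ih =>
    rw [succ_nsmul, ← add_assoc] at hk hk0
    by_cases h1 : 1 ∈ S
    · exact acc_of_zero_mem_of_one_mem hn hp h0 h1 hST ihT ihS
    by_cases hS : -1 ∈ S
    · exact acc_of_hold_of_last_mem hn h0 h1 hS (hST hS) ihT
    have hk' : (1 : Fin n) + k • 1 ≠ 0 := by
      intro h
      rw [h, zero_add] at hk
      exact h1 hk
    refine Acc.ac hn h0 h1 (ih (T := {t | t + 1 ∈ T}) (Or.inl rfl) (Or.inr ⟨hk, hk0⟩) hk'
      (val_hold hn q S _).2.2 ?_ ?_) (mem_iff_shift hST)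
    · rwa [ncard_shift]
    · rwa [ncard_shift, ncard_hold h0 h1]

theorem hold_singleton : {r : Fin n | r = 0 ∨ r + 1 ∈ ({0} : Set (Fin n)) ∧ r + 1 ≠ 0} = {0} := by
  ext r
  simp

theorem acc_singleton_of_mem (hn : 3 ≤ n) (k : ℕ) {q : Fin m}
    {T : Set (Fin p)} (hk : 1 + k • 1 ∈ T)
    (ihT : ∀ (q' : Fin m) (S' : Set (Fin n)) (T' : Set (Fin p)), Val q' S' T' →
      T'.ncard < T.ncard → Acc q' S' T') : Acc q ({0} : Set (Fin n)) T := by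
  have hn0 := neg_one_ne_zero' (show 2 ≤ n by omega)
  have hn1 := neg_one_ne_one hn
  have h10 := one_ne_zero' (show 2 ≤ n by omega)
  induction k generalizing q T with
  | zero =>
    rw [zero_nsmul, add_zero] at hk
    -- The word `ac` merges `{-1, 0}` into `{0}`. The extra element `-1` allows `T`, turned back so
    -- that `1` becomes `0`, to be reached from a smaller set.
    have h₁ : Acc (Equiv.swap 0 1 q) ({-1, 0} : Set (Fin n)) {t | t + 1 ∈ T} := by
      refine acc_of_hold_of_last_mem hn (by simp) (by simp [hn1.symm, h10]) (by simp)
        (by rwa [Set.mem_ofPred_eq, zero_add]) ?_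
      rwa [ncard_shift]
    have h₂ : Acc (Equiv.swap 0 1 q) ({0, 1} : Set (Fin n)) T := by
      refine h₁.a hn (fun r => ?_) fun t => ?_
      · simp only [Set.mem_insert_iff, Set.mem_singleton_iff, sub_eq_neg_self, sub_eq_zero]
        tauto
      · simp [hn0, hn1]
    refine h₂.c hn (Equiv.swap_apply_self _ _ _).symm (fun r => ?_) fun t => ?_
    · simp only [Set.mem_insert_iff, Set.mem_singleton_iff]
      grind
    · simp [hn0]
  | succ k ih =>
    rw [succ_nsmul, ← add_assoc] at hk
    refine Acc.ac hn rfl (fun h => h10 h) (T₀ := {t | t + 1 ∈ T}) ?_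
      (mem_iff_shift fun h => (hn0 h).elim)
    rw [hold_singleton]
    refine ih hk ?_
    rwa [ncard_shift]

theorem acc_empty (hm : 2 ≤ m) (hn : 3 ≤ n) (hp : 2 ≤ p) {q : Fin m} (hq : q ≠ -1) :
    Acc q (∅ : Set (Fin n)) (∅ : Set (Fin p)) := by
  have h0 : Acc (0 : Fin m) (∅ : Set (Fin n)) (∅ : Set (Fin p)) := by
    have h := DFA.Accessible.start (catDFA m n p)
    rwa [start_catDFA hm] at h
  obtain ⟨k, rfl⟩ := exists_nsmul q
  induction k with
  | zero => rwa [zero_nsmul]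
  | succ k ih =>
    -- If the count wraps around, the target is the start state.
    by_cases hk : k • (1 : Fin m) = -1
    · rwa [succ_nsmul, hk, neg_add_cancel]
    · exact (ih hk).b hn hp (succ_nsmul _ _) (by simp [hq]) (by simp)

theorem acc_singleton_empty (hm : 2 ≤ m) (hn : 3 ≤ n) (hp : 2 ≤ p) (q : Fin m) :
    Acc q ({0} : Set (Fin n)) (∅ : Set (Fin p)) := by
  have hn0 := neg_one_ne_zero' (show 2 ≤ n by omega)
  have hn1 := neg_one_ne_one hn
  have h10 := one_ne_zero' (show 2 ≤ n by omega)
  have hlast : Acc (-1 : Fin m) ({0} : Set (Fin n)) (∅ : Set (Fin p)) := by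
    refine (acc_empty hm hn hp (q := -1 - 1) fun h => ?_).b hn hp (sub_add_cancel _ _).symm
      (by simp) (by simp [hn0])
    rw [sub_eq_self] at h
    exact one_ne_zero' hm h
  obtain ⟨k, rfl⟩ := exists_add_nsmul q (-1)
  induction k with
  | zero => rwa [zero_nsmul, add_zero]
  | succ k ih =>
    rw [succ_nsmul, ← add_assoc]
    -- The word `bcac` advances `q` by one: `b` sends `{0}` to `{1}`, `c` contracts it, and `ac`
    -- undoes the transposition that this `c` applies to the first component.
    set q := -1 + k • (1 : Fin m)
    have h₁ : Acc (q + 1) {r : Fin n | r = 1 ∨ q + 1 = -1 ∧ r = 0} (∅ : Set (Fin p)) := by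
      refine ih.b hn hp rfl (fun r => ?_) (by simp [hn0, hn1])
      simp only [Set.mem_ofPred_eq, Set.mem_singleton_iff, Equiv.swap_apply_eq_iff,
        Equiv.swap_apply_left]
    have h₂ : Acc (Equiv.swap 0 1 (q + 1)) ({0} : Set (Fin n)) (∅ : Set (Fin p)) := by
      refine h₁.c hn rfl (fun r => ?_) (by simp [hn0])
      simp only [Set.mem_ofPred_eq, Set.mem_singleton_iff]
      grind
    refine Acc.ac hn rfl (fun h => h10 h) (T₀ := ∅) ?_ (by simp [hn0])
    rwa [hold_singleton]

theorem acc_of_zero_mem (hm : 2 ≤ m) (hn : 3 ≤ n) (hp : 2 ≤ p) {q : Fin m}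
    {S : Set (Fin n)} {T : Set (Fin p)} (h0 : 0 ∈ S) (hST : -1 ∈ S → 0 ∈ T)
    (ihT : ∀ (q' : Fin m) (S' : Set (Fin n)) (T' : Set (Fin p)), Val q' S' T' →
      T'.ncard < T.ncard → Acc q' S' T')
    (ihS : ∀ (q' : Fin m) (S' : Set (Fin n)) (T' : Set (Fin p)), Val q' S' T' →
      T'.ncard = T.ncard → S'.ncard < S.ncard → Acc q' S' T') : Acc q S T := by
  by_cases hS : ∃ x ∈ S, x ≠ 0
  · obtain ⟨x, hx, hx0⟩ := hS
    obtain ⟨k, rfl⟩ := exists_add_nsmul x 1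
    exact acc_of_zero_mem_of_mem hn hp k h0 hx hx0 hST ihT ihS
  · push Not at hS
    obtain rfl : S = {0} := Set.eq_singleton_iff_unique_mem.2 ⟨h0, hS⟩
    rcases T.eq_empty_or_nonempty with rfl | ⟨t, ht⟩
    · exact acc_singleton_empty hm hn hp q
    · obtain ⟨k, rfl⟩ := exists_add_nsmul t 1
      exact acc_singleton_of_mem hn k ht ihT

theorem acc_of_mem (hm : 2 ≤ m) (hn : 3 ≤ n) (hp : 2 ≤ p) (k : ℕ) {q : Fin m}
    {S : Set (Fin n)} {T : Set (Fin p)} (hk : k • 1 ∈ S) (hq : q = -1 → 0 ∈ S)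
    (hST : -1 ∈ S → 0 ∈ T)
    (ihT : ∀ (q' : Fin m) (S' : Set (Fin n)) (T' : Set (Fin p)), Val q' S' T' →
      T'.ncard < T.ncard → Acc q' S' T')
    (ihS : ∀ (q' : Fin m) (S' : Set (Fin n)) (T' : Set (Fin p)), Val q' S' T' →
      T'.ncard = T.ncard → S'.ncard < S.ncard → Acc q' S' T') : Acc q S T := by
  induction k generalizing S T with
  | zero =>
    rw [zero_nsmul] at hk
    exact acc_of_zero_mem hm hn hp hk hST ihT ihS
  | succ k ih =>
    by_cases h0 : 0 ∈ S
    · exact acc_of_zero_mem hm hn hp h0 hST ihT ihS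
    rw [succ_nsmul] at hk
    have hq' : q ≠ -1 := fun h => h0 (hq h)
    refine acc_of_not_final hn hq' hST (ih hk (fun h => (hq' h).elim) (fun h => ?_) ?_ ?_)
    · rw [Set.mem_ofPred_eq, neg_add_cancel] at h
      exact (h0 h).elim
    · rwa [ncard_shift]
    · rwa [ncard_shift, ncard_shift]

theorem acc_of_val (hm : 2 ≤ m) (hn : 3 ≤ n) (hp : 2 ≤ p) (q : Fin m) (S : Set (Fin n))
    (T : Set (Fin p)) (h : Val q S T) : Acc q S T := by
  induction ht : T.ncard using Nat.strong_induction_on generalizing q S T with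
  | _ t ihT =>
    induction hs : S.ncard using Nat.strong_induction_on generalizing q S T with
    | _ s ihS =>
      rcases S.eq_empty_or_nonempty with rfl | ⟨r, hr⟩
      · obtain rfl := h.1 rfl
        exact acc_empty hm hn hp fun hq => h.2.1 hq
      · obtain ⟨k, rfl⟩ := exists_nsmul r
        refine acc_of_mem hm hn hp k hr h.2.1 h.2.2 ?_ ?_
        · intro q' S' T' h' hlt
          exact ihT _ (ht ▸ hlt) q' S' T' h' rfl
        · intro q' S' T' h' heq hlt
          exact ihS _ (hs ▸ hlt) q' S' T' h' (heq.trans ht) rfl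

end Brzozowski

/-! ### Inequivalence of distinct states -/

namespace Brzozowski

variable {m n p : ℕ} [NeZero m] [NeZero n] [NeZero p]

theorem val_sub_one {n : ℕ} [NeZero n] (hn : 2 ≤ n) {x : Fin n} (hx : x ≠ 0) :
    (x : ℕ) = (x - 1 : Fin n) + 1 := by
  have hx' : (x : ℕ) ≠ 0 := fun h => hx (Fin.ext h)
  have h1 : ((1 : Fin n) : ℕ) = 1 := by rw [Fin.val_one', Nat.mod_eq_of_lt (by omega)]
  have hlt := x.isLt
  rw [Fin.val_sub_one_of_ne_zero hx]
  omega

/-! ### Equivalent states have the same third component. -/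

theorem third_subset_of_stateEquiv (hn : 2 ≤ n) {s t : Fin m × Set (Fin n) × Set (Fin p)}
    (h : (catDFA m n p).StateEquiv s t) : s.2.2 ⊆ t.2.2 := by
  intro x hx
  obtain ⟨k, rfl⟩ := exists_sub_nsmul x (-1)
  induction k generalizing s t with
  | zero =>
    rw [zero_nsmul, sub_zero] at hx ⊢
    exact (mem_accept_catDFA t).1 (h.mem_accept.1 ((mem_accept_catDFA s).2 hx))
  | succ k ih =>
    -- The final state is treated directly; any other place turns to a nonzero one, which a newly
    -- created `0` cannot imitate.
    by_cases hk : -1 - (k + 1) • (1 : Fin p) = -1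
    · rw [hk] at hx ⊢
      exact (mem_accept_catDFA t).1 (h.mem_accept.1 ((mem_accept_catDFA s).2 hx))
    have hk1 : -1 - k • (1 : Fin p) - 1 = -1 - (k + 1) • (1 : Fin p) := by
      rw [succ_nsmul]
      abel
    obtain ⟨q, S, T⟩ := s
    obtain ⟨q', S', T'⟩ := t
    have h' := h.step Letter.a
    rw [step_a hn, step_a hn] at h'
    rcases ih h' (Or.inl (hk1 ▸ hx)) with h₁ | ⟨-, h₁⟩
    · exact hk1 ▸ h₁
    · rw [h₁, zero_sub] at hk1
      exact (hk hk1.symm).elim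

theorem third_eq_of_stateEquiv (hn : 2 ≤ n) {s t : Fin m × Set (Fin n) × Set (Fin p)}
    (h : (catDFA m n p).StateEquiv s t) : s.2.2 = t.2.2 :=
  (third_subset_of_stateEquiv hn h).antisymm (third_subset_of_stateEquiv hn h.symm)

/-! ### Equivalent states have the same second component. -/

/-- The nonzero elements of `S` are at least `k`. -/
def Low {n : ℕ} [NeZero n] (k : ℕ) (S : Set (Fin n)) : Prop :=
  ∀ x ∈ S, x ≠ 0 → k ≤ x

theorem low_zero {n : ℕ} [NeZero n] (S : Set (Fin n)) : Low 0 S := fun _ _ _ => Nat.zero_le _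

theorem Low.eq_zero {n k : ℕ} [NeZero n] {S : Set (Fin n)} (h : Low k S) (hk : n ≤ k) {x : Fin n}
    (hx : x ∈ S) : x = 0 := by
  by_contra hx0
  have := h x hx hx0
  have := x.isLt
  omega

/-- `S` is obtained from a turn of `S₀` followed by the contraction, up to the state `0`. -/
theorem Low.succ {n k : ℕ} [NeZero n] (hn : 2 ≤ n) {S₀ S : Set (Fin n)} (h : Low k S₀)
    (hS : ∀ x ∈ S, x ≠ 0 → x ≠ 1 ∧ x - 1 ∈ S₀) : Low (k + 1) S := by
  intro x hx hx0
  obtain ⟨h1, hx'⟩ := hS x hx hx0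
  have := h _ hx' (by rwa [Ne, sub_eq_zero])
  rw [val_sub_one hn hx0]
  omega

theorem swap_add_one {d : Fin n} (hd : d ≠ 0) (hd' : d ≠ -1) :
    Equiv.swap 0 1 (d + 1) = d + 1 := by
  refine Equiv.swap_apply_of_ne_of_ne (fun h => hd' (eq_neg_of_add_eq_zero_left h)) fun h => hd ?_
  rwa [add_eq_right] at h

/-- Nonzero elements move up by one or wrap to `0`, while `0` goes to `1` and back. It serves for
third components under `ab` and for second components under `ac`. -/
theorem low_turn_contract (hp : 2 ≤ p) {k : ℕ} {T : Set (Fin p)} (h : Low k T) (P Q : Prop) :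
    Low (k + 1) {t : Fin p | (t ≠ 1 ∧ t ∈ {t | t - 1 ∈ T ∨ P ∧ t = 0} ∨
      t = 0 ∧ 1 ∈ {t | t - 1 ∈ T ∨ P ∧ t = 0}) ∨ Q ∧ t = 0} := by
  refine h.succ hp ?_
  rintro x ((⟨hx1, hx | ⟨-, hx⟩⟩ | ⟨hx, -⟩) | ⟨-, hx⟩) hx0
  · exact ⟨hx1, hx⟩
  all_goals exact (hx0 hx).elim

/-- Two equivalent states lead to equivalent states whose second components differ at the next
place, the third component being contracted. -/
theorem exists_rotate (hm : 2 ≤ m) (hn : 3 ≤ n) (hp : 2 ≤ p) {k : ℕ}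
    {q q' : Fin m} {S S' : Set (Fin n)} {T T' : Set (Fin p)}
    (h : (catDFA m n p).StateEquiv (q, S, T) (q', S', T')) {d : Fin n} (hd0 : d ≠ 0)
    (hd : d ∈ S) (hd' : d ∉ S') (hT : Low k T') :
    ∃ (q₁ q₁' : Fin m) (S₁ S₁' : Set (Fin n)) (T₁ T₁' : Set (Fin p)),
      (catDFA m n p).StateEquiv (q₁, S₁, T₁) (q₁', S₁', T₁') ∧
      (if d = -1 then 1 else d + 1) ∈ S₁ ∧ (if d = -1 then 1 else d + 1) ∉ S₁' ∧
      Low (k + 1) T₁' := by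
  have hn0 := neg_one_ne_zero' (show 2 ≤ n by omega)
  have hn1 := neg_one_ne_one hn
  have h10 := one_ne_zero' (show 2 ≤ n by omega)
  have ab : ∀ {q q' : Fin m} {S S' : Set (Fin n)} {T T' : Set (Fin p)},
      (catDFA m n p).StateEquiv (q, S, T) (q', S', T') → d ∈ S → d ∉ S' → Low k T' →
      (d = -1 → q' ≠ -1) →
      ∃ (q₁ q₁' : Fin m) (S₁ S₁' : Set (Fin n)) (T₁ T₁' : Set (Fin p)),
        (catDFA m n p).StateEquiv (q₁, S₁, T₁) (q₁', S₁', T₁') ∧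
        (if d = -1 then 1 else d + 1) ∈ S₁ ∧ (if d = -1 then 1 else d + 1) ∉ S₁' ∧
        Low (k + 1) T₁' := by
    intro q q' S S' T T' h hd hd' hT hq
    have h' := (h.step Letter.a).step Letter.b
    rw [step_a (by omega), step_a (by omega), step_b hn hp, step_b hn hp] at h'
    refine ⟨_, _, _, _, _, _, h', ?_, ?_, low_turn_contract hp hT _ _⟩
    · split_ifs with hdl
      · left
        subst hdl
        rw [Equiv.swap_apply_right]
        left
        rwa [zero_sub]
      · left
        rw [swap_add_one hd0 hdl]
        left
        rwa [add_sub_cancel_right]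
    · split_ifs with hdl
      · subst hdl
        rintro (h₁ | ⟨-, h₁⟩)
        · rw [Equiv.swap_apply_right] at h₁
          rcases h₁ with h₁ | ⟨h₁, -⟩
          · rw [zero_sub] at h₁
            exact hd' h₁
          · exact hq rfl h₁
        · exact h10 h₁
      · have hne : d + 1 ≠ 0 := fun h => hdl (eq_neg_of_add_eq_zero_left h)
        rintro (h₁ | ⟨-, h₁⟩)
        · rw [swap_add_one hd0 hdl] at h₁
          rcases h₁ with h₁ | ⟨-, h₁⟩
          · rw [add_sub_cancel_right] at h₁
            exact hd' h₁
          · exact hne h₁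
        · exact hne h₁
  -- Here `a` would turn `d` to `0` and also create `0` in `S'`, losing the difference. A
  -- preliminary `b` fixes `d = -1` and moves `q'` off the final state.
  by_cases hq : d = -1 ∧ q' = -1
  · obtain ⟨hdl, rfl⟩ := hq
    have hsw : Equiv.swap 0 1 d = d := by
      rw [hdl]
      exact Equiv.swap_apply_of_ne_of_ne hn0 hn1
    have h' := h.step Letter.b
    rw [step_b hn hp, step_b hn hp] at h'
    refine ab h' (Or.inl (by rwa [hsw])) ?_ ?_ fun _ => ?_
    · rintro (h₁ | ⟨-, h₁⟩)
      · rw [hsw] at h₁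
        exact hd' h₁
      · exact hd0 h₁
    · rintro x ((⟨-, hx⟩ | ⟨hx, -⟩) | ⟨-, hx⟩) hx0
      · exact hT x hx hx0
      all_goals exact (hx0 hx).elim
    · intro h₁
      rw [add_eq_left] at h₁
      exact one_ne_zero' hm h₁
  · exact ab h hd hd' hT fun h₁ h₂ => hq ⟨h₁, h₂⟩

theorem val_add_one {n : ℕ} [NeZero n] {x : Fin n} (hx : (x : ℕ) + 1 < n) :
    ((x + 1 : Fin n) : ℕ) = x + 1 := by
  rw [Fin.val_add, Fin.val_one', Nat.mod_eq_of_lt (show 1 < n by omega), Nat.mod_eq_of_lt hx]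

theorem add_one_eq_zero {n : ℕ} [NeZero n] {x : Fin n} (hx : ¬ (x : ℕ) + 1 < n) : x + 1 = 0 := by
  have hlt := x.isLt
  rcases Nat.lt_or_ge 1 n with h | h
  · rw [Fin.ext_iff, Fin.val_add, Fin.val_one', Nat.mod_eq_of_lt h,
      show (x : ℕ) + 1 = n by omega, Nat.mod_self, Fin.val_zero]
  · obtain rfl : n = 1 := by omega
    exact Subsingleton.elim _ _

theorem rotate_ne_zero (hn : 3 ≤ n) (d : Fin n) : (if d = -1 then 1 else d + 1) ≠ 0 := by
  split_ifs with h
  · exact one_ne_zero' (by omega)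
  · exact fun h' => h (eq_neg_of_add_eq_zero_left h')

theorem exists_low (hm : 2 ≤ m) (hn : 3 ≤ n) (hp : 2 ≤ p) (k : ℕ)
    {q q' : Fin m} {S S' : Set (Fin n)} {T T' : Set (Fin p)}
    (h : (catDFA m n p).StateEquiv (q, S, T) (q', S', T')) {d : Fin n} (hd0 : d ≠ 0)
    (hd : d ∈ S) (hd' : d ∉ S') :
    ∃ (e : Fin n) (q₁ q₁' : Fin m) (S₁ S₁' : Set (Fin n)) (T₁ T₁' : Set (Fin p)),
      (catDFA m n p).StateEquiv (q₁, S₁, T₁) (q₁', S₁', T₁') ∧ e ≠ 0 ∧ e ∈ S₁ ∧ e ∉ S₁' ∧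
      Low k T₁' := by
  induction k with
  | zero => exact ⟨d, _, _, _, _, _, _, h, hd0, hd, hd', low_zero _⟩
  | succ k ih =>
    obtain ⟨e, _, _, _, _, _, _, h₁, he0, he, he', hT⟩ := ih
    obtain ⟨_, _, _, _, _, _, h₂, hd₂, hd₂', hT₂⟩ := exists_rotate hm hn hp h₁ he0 he he' hT
    exact ⟨_, _, _, _, _, _, _, h₂, rotate_ne_zero hn e, hd₂, hd₂', hT₂⟩

theorem not_stateEquiv_of_low (hm : 2 ≤ m) (hn : 3 ≤ n) (hp : 2 ≤ p) (j : ℕ) {k : ℕ} (hk : p ≤ k)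
    {q q' : Fin m} {S S' : Set (Fin n)} {T T' : Set (Fin p)} {d : Fin n} (hd0 : d ≠ 0)
    (hd : d ∈ S) (hd' : d ∉ S') (hT : Low k T') (hj : (d : ℕ) + j + 2 = n) :
    ¬ (catDFA m n p).StateEquiv (q, S, T) (q', S', T') := by
  intro h
  induction j generalizing q q' S S' T T' d k with
  | zero =>
    have hdl : d = -1 - 1 := by
      have h₁ : ((d + 1 : Fin n) : ℕ) = d + 1 := val_add_one (by omega)
      have h₂ : d + 1 + 1 = 0 := add_one_eq_zero (by omega)
      rw [eq_sub_iff_add_eq, eq_neg_iff_add_eq_zero, h₂]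
    have h' := h.step Letter.a
    rw [step_a (by omega), step_a (by omega)] at h'
    -- The element `d` arrives at `-1` and creates `0` on the left. On the right `0` would need `-1
    -- ∈ T'`, impossible as `T' ⊆ {0}`, or `d ∈ S'`.
    have h0 := third_subset_of_stateEquiv (by omega) h' (Or.inr ⟨hdl ▸ hd, rfl⟩)
    rcases h0 with h0 | ⟨h0, -⟩
    · rw [zero_sub] at h0
      exact neg_one_ne_zero' hp (hT.eq_zero hk h0)
    · exact hd' (hdl ▸ h0)
  | succ j ih =>
    have h₁ : ((d + 1 : Fin n) : ℕ) = d + 1 := val_add_one (by omega)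
    have hdl : d ≠ -1 := by
      rintro rfl
      rw [neg_add_cancel, Fin.val_zero] at h₁
      omega
    obtain ⟨_, _, _, _, _, _, h₂, hd₂, hd₂', hT₂⟩ := exists_rotate hm hn hp h hd0 hd hd' hT
    rw [if_neg hdl] at hd₂ hd₂'
    refine ih (by omega) (fun h => hdl (eq_neg_of_add_eq_zero_left h)) hd₂ hd₂' hT₂ (by omega) h₂

theorem second_subset_of_stateEquiv_of_ne_zero (hm : 2 ≤ m) (hn : 3 ≤ n) (hp : 2 ≤ p)
    {q q' : Fin m} {S S' : Set (Fin n)} {T T' : Set (Fin p)}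
    (h : (catDFA m n p).StateEquiv (q, S, T) (q', S', T')) {d : Fin n} (hd0 : d ≠ 0)
    (hd : d ∈ S) : d ∈ S' := by
  by_contra hd'
  obtain ⟨e, q₁, q₁', S₁, S₁', T₁, T₁', h₁, he0, he, he', hT⟩ :=
    exists_low hm hn hp p h hd0 hd hd'
  by_cases hlt : (e : ℕ) + 1 < n
  · exact not_stateEquiv_of_low hm hn hp (n - 2 - e) le_rfl he0 he he' hT (by omega) h₁
  -- The place `-1 - 1` is already passed; one more rotation restarts at `1`.
  · have hel : e = -1 := eq_neg_of_add_eq_zero_left (add_one_eq_zero hlt)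
    obtain ⟨_, _, _, _, _, _, h₂, hd₂, hd₂', hT₂⟩ := exists_rotate hm hn hp h₁ he0 he he' hT
    rw [if_pos hel] at hd₂ hd₂'
    have hv : ((1 : Fin n) : ℕ) = 1 := by rw [Fin.val_one', Nat.mod_eq_of_lt (by omega)]
    exact not_stateEquiv_of_low hm hn hp (n - 3) (Nat.le_succ p) (one_ne_zero' (by omega))
      hd₂ hd₂' hT₂ (by omega) h₂

theorem second_subset_of_stateEquiv (hm : 2 ≤ m) (hn : 3 ≤ n) (hp : 2 ≤ p)
    {q q' : Fin m} {S S' : Set (Fin n)} {T T' : Set (Fin p)}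
    (h : (catDFA m n p).StateEquiv (q, S, T) (q', S', T')) : S ⊆ S' := by
  intro d hd
  by_cases hd0 : d = 0
  · subst hd0
    have h10 := one_ne_zero' (show 2 ≤ n by omega)
    have h' := h.step Letter.a
    rw [step_a (by omega), step_a (by omega)] at h'
    have h1 := second_subset_of_stateEquiv_of_ne_zero hm hn hp h' (d := 1) h10
      (Or.inl (by rwa [sub_self]))
    rcases h1 with h1 | ⟨-, h1⟩
    · rwa [sub_self] at h1
    · exact (h10 h1).elim
  · exact second_subset_of_stateEquiv_of_ne_zero hm hn hp h hd0 hd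

/-! ### Equivalent states have the same first component. -/

/-- The word `acac` preserves the first component and contracts the second one. -/
theorem exists_low_second (hn : 3 ≤ n) (k : ℕ) {q q' : Fin m} {S S' : Set (Fin n)}
    {T T' : Set (Fin p)} (h : (catDFA m n p).StateEquiv (q, S, T) (q', S', T')) :
    ∃ (S₁ S₁' : Set (Fin n)) (T₁ T₁' : Set (Fin p)),
      (catDFA m n p).StateEquiv (q, S₁, T₁) (q', S₁', T₁') ∧ Low k S₁ := by
  have low_ac : ∀ {k : ℕ} {S : Set (Fin n)}, Low k S → ∀ P Q : Prop,
      Low (k + 1) {r | (r ≠ 1 ∧ r ∈ {r | r - 1 ∈ S ∨ P ∧ r = 0} ∨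
        r = 0 ∧ 1 ∈ {r | r - 1 ∈ S ∨ P ∧ r = 0}) ∨ Q ∧ r = 0} :=
    fun h P Q => low_turn_contract (by omega) h P Q
  induction k with
  | zero => exact ⟨_, _, _, _, h, low_zero _⟩
  | succ k ih =>
    obtain ⟨_, _, _, _, h₁, hS⟩ := ih
    have h₂ := (h₁.step Letter.a).step Letter.c
    rw [step_a (by omega), step_a (by omega), step_c hn, step_c hn] at h₂
    have h₃ := (h₂.step Letter.a).step Letter.c
    rw [step_a (by omega), step_a (by omega), step_c hn, step_c hn, Equiv.swap_apply_self,
      Equiv.swap_apply_self] at h₃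
    refine ⟨_, _, _, _, h₃, fun x hx hx0 => ?_⟩
    exact (Nat.le_succ _).trans (low_ac (low_ac hS _ _) _ _ x hx hx0)

theorem first_eq_of_stateEquiv (hm : 2 ≤ m) (hn : 3 ≤ n) (hp : 2 ≤ p)
    {q q' : Fin m} {S S' : Set (Fin n)} {T T' : Set (Fin p)}
    (h : (catDFA m n p).StateEquiv (q, S, T) (q', S', T')) : q = q' := by
  obtain ⟨k, hk⟩ := exists_sub_nsmul q' (-1)
  induction k generalizing q q' S S' T T' with
  | zero =>
    rw [zero_nsmul, sub_zero] at hk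
    obtain ⟨S₁, S₁', T₁, T₁', h₁, hS⟩ := exists_low_second hn n h
    have h₂ := h₁.step Letter.a
    rw [step_a (by omega), step_a (by omega)] at h₂
    -- As `q' = -1`, the letter `a` creates `0` on the right. On the left `-1 ∈ S₁` is excluded by
    -- `S₁ ⊆ {0}`, so `q` is final too.
    have h0 := second_subset_of_stateEquiv hm hn hp h₂.symm (Or.inr ⟨hk, rfl⟩)
    rcases h0 with h0 | ⟨h0, -⟩
    · rw [zero_sub] at h0
      exact (neg_one_ne_zero' (by omega) (hS.eq_zero le_rfl h0)).elim
    · rw [h0, hk]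
  | succ k ih =>
    have h' := h.step Letter.b
    rw [step_b hn hp, step_b hn hp] at h'
    refine add_right_cancel (ih h' ?_)
    rw [hk, succ_nsmul]
    abel

theorem eq_of_stateEquiv (hm : 2 ≤ m) (hn : 3 ≤ n) (hp : 2 ≤ p)
    {s t : Fin m × Set (Fin n) × Set (Fin p)} (h : (catDFA m n p).StateEquiv s t) : s = t := by
  obtain ⟨q, S, T⟩ := s
  obtain ⟨q', S', T'⟩ := t
  refine Prod.ext (first_eq_of_stateEquiv hm hn hp h) (Prod.ext ?_ ?_)
  · exact (second_subset_of_stateEquiv hm hn hp h).antisymm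
      (second_subset_of_stateEquiv hm hn hp h.symm)
  · exact third_eq_of_stateEquiv (by omega) h

end Brzozowski

theorem validTriples_brzozowski {m n p : ℕ} [NeZero m] [NeZero n] [NeZero p] :
    validTriples (witnessDFA₁ m).accept (witnessDFA₂ n).start (witnessDFA₂ n).accept
      (witnessDFA₃ p).start = validTriples {(-1 : Fin m)} (0 : Fin n) {-1} (0 : Fin p) := by
  have h₁ : (witnessDFA₁ m).accept = {-1} := Set.ext Brzozowski.mem_accept_iff
  have h₂ : (witnessDFA₂ n).accept = {-1} := Set.ext Brzozowski.mem_accept_iff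
  rw [h₁, h₂]
  rfl

theorem mainTheorem4 (m n p : ℕ) [NeZero m] [NeZero n] [NeZero p]
    (hm : 2 ≤ m) (hn : 3 ≤ n) (hp : 2 ≤ p) :
    -- the accessible states of the catenation DFA are exactly the valid states
    (∀ s : Set ((Fin m ⊕ Fin n) ⊕ Fin p),
      (tripleCatDFA (witnessDFA₁ m) (witnessDFA₂ n) (witnessDFA₃ p)).Accessible s ↔
        s ∈ validStates (witnessDFA₁ m) (witnessDFA₂ n) (witnessDFA₃ p)) ∧
    -- distinct valid states are not equivalent
    (∀ s ∈ validStates (witnessDFA₁ m) (witnessDFA₂ n) (witnessDFA₃ p),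
      ∀ t ∈ validStates (witnessDFA₁ m) (witnessDFA₂ n) (witnessDFA₃ p),
        s ≠ t →
          ¬ (tripleCatDFA (witnessDFA₁ m) (witnessDFA₂ n) (witnessDFA₃ p)).StateEquiv s t) ∧
    -- the number of valid states
    ((validStates (witnessDFA₁ m) (witnessDFA₂ n) (witnessDFA₃ p)).ncard : ℚ) =
      (m : ℚ) - 1 + 3 / 8 * 2 ^ (p + n) * (2 * (m : ℚ) - 1) + 2 ^ p * (1 - (m : ℚ)) ∧
    -- it is the state complexity of the catenation of the three languages
    HasStateComplexity
      ((witnessDFA₁ m).accepts * (witnessDFA₂ n).accepts * (witnessDFA₃ p).accepts)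
      (validStates (witnessDFA₁ m) (witnessDFA₂ n) (witnessDFA₃ p)).ncard ∧
    -- the three languages form a witness
    IsTripleCatWitness m n p
      (witnessDFA₁ m).accepts (witnessDFA₂ n).accepts (witnessDFA₃ p).accepts := by
  have hacc : ∀ s : Set ((Fin m ⊕ Fin n) ⊕ Fin p),
      (tripleCatDFA (witnessDFA₁ m) (witnessDFA₂ n) (witnessDFA₃ p)).Accessible s ↔
        s ∈ validStates (witnessDFA₁ m) (witnessDFA₂ n) (witnessDFA₃ p) := by
    intro X
    rw [accessible_tripleCatDFA_iff, validStates_eq_image]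
    constructor
    · rintro ⟨s, hs, rfl⟩
      exact ⟨s, accessible_mem_validTriples _ _ _ hs, rfl⟩
    · rintro ⟨s, hs, rfl⟩
      rw [validTriples_brzozowski] at hs
      exact ⟨s, Brzozowski.acc_of_val hm hn hp _ _ _
        ⟨hs.1, hs.2.1, fun h => hs.2.2 _ h rfl⟩, rfl⟩
  have hne : ∀ s ∈ validStates (witnessDFA₁ m) (witnessDFA₂ n) (witnessDFA₃ p),
      ∀ t ∈ validStates (witnessDFA₁ m) (witnessDFA₂ n) (witnessDFA₃ p),
        s ≠ t →
          ¬ (tripleCatDFA (witnessDFA₁ m) (witnessDFA₂ n) (witnessDFA₃ p)).StateEquiv s t := by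
    intro X hX Y hY hXY h
    rw [validStates_eq_image] at hX hY
    obtain ⟨s, -, rfl⟩ := hX
    obtain ⟨t, -, rfl⟩ := hY
    rw [stateEquiv_tripleToSet_iff] at h
    exact hXY (congrArg _ (Brzozowski.eq_of_stateEquiv hm hn hp h))
  have hncard : (validStates (witnessDFA₁ m) (witnessDFA₂ n) (witnessDFA₃ p)).ncard =
      2 ^ (n - 2) * 2 ^ (p - 1) + 2 ^ (n - 2) * 2 ^ p +
        (m - 1) * (1 + 2 ^ (n - 1) * 2 ^ (p - 1) + (2 ^ (n - 1) - 1) * 2 ^ p) := by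
    rw [validStates_eq_image, Set.ncard_image_of_injective _ tripleToSet_injective,
      validTriples_brzozowski,
      ncard_validTriples_eq _ (Brzozowski.neg_one_ne_zero' (by omega)).symm]
    simp only [Fintype.card_fin]
  have hsc : HasStateComplexity
      ((witnessDFA₁ m).accepts * (witnessDFA₂ n).accepts * (witnessDFA₃ p).accepts)
      (validStates (witnessDFA₁ m) (witnessDFA₂ n) (witnessDFA₃ p)).ncard := by
    rw [← accepts_tripleCatDFA]
    exact hasStateComplexity_ncard _ _ (Set.toFinite _) hacc hne
  have h₁ : HasStateComplexity (witnessDFA₁ m).accepts m :=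
    Brzozowski.hasStateComplexity_brzozowskiDFA (x := Letter.b) rfl
  have h₂ : HasStateComplexity (witnessDFA₂ n).accepts n :=
    Brzozowski.hasStateComplexity_brzozowskiDFA (x := Letter.a) rfl
  have h₃ : HasStateComplexity (witnessDFA₃ p).accepts p :=
    Brzozowski.hasStateComplexity_brzozowskiDFA (x := Letter.a) rfl
  have hLetter : Finite Letter :=
    Finite.of_surjective (fun i : Fin 3 => ![Letter.a, Letter.b, Letter.c] i)
      (by rintro (_ | _ | _); exacts [⟨0, rfl⟩, ⟨1, rfl⟩, ⟨2, rfl⟩])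
  refine ⟨hacc, hne, ?_, hsc, h₁, h₂, h₃, _, hsc, ⟨Letter, hLetter, _, _, _, h₁, h₂, h₃, hsc⟩, ?_⟩
  · rw [hncard]
    exact cast_ncard_formula m n p (by omega) (by omega) (by omega)
  · rintro k ⟨α, -, L₁, L₂, L₃, hL₁, hL₂, hL₃, hk⟩
    obtain ⟨Q₁, _, M₁, rfl, hQ₁⟩ := hL₁.1
    obtain ⟨Q₂, _, M₂, rfl, hQ₂⟩ := hL₂.1
    obtain ⟨Q₃, _, M₃, rfl, hQ₃⟩ := hL₃.1
    -- For the upper bound it is enough that the valid triples contain the start and are closed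
    -- under the transitions.
    have hle := hk.le_ncard (tripleDFA M₁ M₂ M₃) (accepts_tripleDFA M₁ M₂ M₃) _ (Set.toFinite _)
      (start_mem_validTriples M₁ M₂ M₃) fun s hs x => step_mem_validTriples M₁ M₂ M₃ hs x
    refine hle.trans ?_
    rw [hncard, ← hQ₁, ← hQ₂, ← hQ₃]
    exact ncard_validTriples_le (by omega) (hL₁.accept_nonempty M₁ hm) _
      (hL₂.accept_nonempty M₂ (by omega)) _
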